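/- Let $n\ge 4$ and let $\tilde\gamma:[a,b]\to\mathbb{R}^n$ ($a<b$) be a smooth ($C^\infty$ on $[a,b]$) curve with $\tilde\gamma'(t)\ne 0$ for all $t\in[a,b]$, $\tilde\gamma(a)=\tilde\gamma(b)$, $\tilde\gamma'(a)=\tilde\gamma'(b)$, and $\tilde\gamma(t_1)\neq\tilde\gamma(t_2)$ whenever $t_1\ne t_2$ in $[a,b)$. Put $\tilde\Gamma=\tilde\gamma([a,b])$ and, for $\varepsilon>0$, $\tilde T_\varepsilon(\tilde\Gamma)=\{x\in\mathbb{R}^n:\operatorname{dist}(x,\tilde\Gamma)<\varepsilon\}$. Let $f:\mathbb{R}\to\mathbb{R}$ be continuous and suppose that, for some real $p>\frac{2(n-1)}{n-3}$, $$t f(t)\ \ge\ p\int_0^t f(\tau)\,d\tau\ \ge\ 0\qquad\text{for all } t\in\mathbb{R}.$$ Then there exists $\tilde\varepsilon>0$ such that, for every $\varepsilon\in(0,\tilde\varepsilon)$, the Dirichlet problem $$\Delta u+f(u)=0\ \text{ in }\Omega,\qquad u=0\ \text{ on }\partial\Omega,$$ in the domain $\Omega=\tilde T_\varepsilon(\tilde\Gamma)$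 has $u\equiv 0$ as its only solution. Here a solution is a real-valued function $u\in C^1(\overline\Omega)$ (no sign condition) that vanishes on $\partial\Omega$ and satisfies the equation in the weak sense, that is, $\int_\Omega \nabla u\cdot\nabla\varphi\,dx=\int_\Omega f(u)\varphi\,dx$ for all $\varphi\in C_c^\infty(\Omega)$; in particular every $u\in C^2(\Omega)\cap C^1(\overline\Omega)$ that solves the problem pointwise is one. -/

import Mathlib

open Set MeasureTheory
open scoped ContDiff

/-- `γ`, restricted to `[a, b]`, is a regular simple closed curve in `ℝⁿ`: it is `C^∞` on `[a, b]`
(one-sided derivatives at the end points), its velocity never vanishes, `γ` and `γ'` take the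
same value at `a` and at `b`, and `γ` is injective on `[a, b)`. -/
structure IsSmoothSimpleClosedCurve {n : ℕ} (γ : ℝ → EuclideanSpace ℝ (Fin n)) (a b : ℝ) :
    Prop where
  lt : a < b
  contDiffOn : ContDiffOn ℝ ∞ γ (Icc a b)
  deriv_ne_zero : ∀ t ∈ Icc a b, derivWithin γ (Icc a b) t ≠ 0
  closed : γ a = γ b
  deriv_closed : derivWithin γ (Icc a b) a = derivWithin γ (Icc a b) b
  injOn : InjOn γ (Ico a b)

/-- `u ∈ C¹(closure Ω)` for an open set `Ω`: `u` is continuous on the closure of `Ω`,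
differentiable in `Ω`, and its gradient extends continuously to the closure of `Ω`. -/
def IsC1UpToBoundary {n : ℕ} (Ω : Set (EuclideanSpace ℝ (Fin n)))
    (u : EuclideanSpace ℝ (Fin n) → ℝ) : Prop :=
  ContinuousOn u (closure Ω) ∧
    ∃ G : EuclideanSpace ℝ (Fin n) → EuclideanSpace ℝ (Fin n),
      ContinuousOn G (closure Ω) ∧ ∀ x ∈ Ω, HasGradientAt u (G x) x

/-- `Δu + f(u) = 0` in `Ω`, tested against `C^∞` functions with compact support in `Ω`
(for `u` of class `C²` in `Ω` this is the pointwise equation). -/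
def WeaklySolves {n : ℕ} (f : ℝ → ℝ) (Ω : Set (EuclideanSpace ℝ (Fin n)))
    (u : EuclideanSpace ℝ (Fin n) → ℝ) : Prop :=
  ∀ φ : EuclideanSpace ℝ (Fin n) → ℝ,
    ContDiff ℝ ∞ φ → HasCompactSupport φ → tsupport φ ⊆ Ω →
      ∫ x in Ω, inner ℝ (gradient u x) (gradient φ x) = ∫ x in Ω, f (u x) * φ x

/-- `u` is a solution of the Dirichlet problem `Δu + f(u) = 0` in `Ω`, `u = 0` on `∂Ω`. -/
structure IsDirichletSolution {n : ℕ} (f : ℝ → ℝ) (Ω : Set (EuclideanSpace ℝ (Fin n)))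
    (u : EuclideanSpace ℝ (Fin n) → ℝ) : Prop where
  regular : IsC1UpToBoundary Ω u
  equation : WeaklySolves f Ω u
  boundary : ∀ x ∈ frontier Ω, u x = 0

/-! The engine is a Pohozaev inequality for a vector field adapted to the tube. Let `P` be a
nearest-point map onto the curve and `V x = x - P x`. Close to the curve the increments of `V` are,
up to a small relative error, those of the orthogonal projection along the unit tangent. A smooth
field `W` close to `V` therefore satisfies `⟨DW ξ, ξ⟩ ≤ (1 + κ)|ξ|²` and `|div W - (n - 1)| ≤ nκ`,
with `κ` as small as desired once the tube is thin. With `F` the primitive of `f` vanishing at `0`,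
such a field gives `0 ≤ ∫ ⟨DW ∇u, ∇u⟩ + div W (F(u) - |∇u|²/2)`. Inserting `∫ |∇u|² = ∫ u f(u)` and
`0 ≤ p F(u) ≤ u f(u)` bounds the right side by `(1 - (n-1)/2 + (n-1)/p + O(κ)) ∫ |∇u|²`. For `κ = 0`
the coefficient is negative exactly when `p > 2(n-1)/(n-3)`, so `∇u = 0`, and the boundary condition
gives `u = 0`.

Neither tubular coordinates nor uniqueness of nearest points is needed: `P` is an arbitrary
selection, the estimate of `exists_nearest_point_map` plays the role of differentiability, and
`exists_outward_field` mollifies `V`.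

Boundary integrals and second derivatives of `u` are avoided as well. In `pohozaev_inequality`, `u`
is compared with `u ∘ Φₛ`, where `Φₛ = id + sW` maps the complement of the tube into itself, so that
`u ∘ Φₛ` still vanishes outside the tube. The weak equation and a change of variables identify an
energy difference with `½ ∫ |∇(u ∘ Φₛ) - ∇u|² ≥ 0`; dividing by `s` and letting `s → 0⁺` gives the
inequality. That `u` and `u ∘ Φₛ` are legitimate test functions is `IsZeroExtension.weak_equation`,
proved by truncating small values. -/

namespace IsSmoothSimpleClosedCurve

/-! ### Geometry of the curve and of its nearest-point maps. -/

variable {n : ℕ} {γ : ℝ → EuclideanSpace ℝ (Fin n)} {a b : ℝ}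

theorem exists_taylor_bound (hγ : IsSmoothSimpleClosedCurve γ a b) :
    ∃ C > 0, ∀ s ∈ Icc a b, ∀ t ∈ Icc a b,
      ‖derivWithin γ (Icc a b) t - derivWithin γ (Icc a b) s‖ ≤ C * |t - s| ∧
        ‖γ t - γ s - (t - s) • derivWithin γ (Icc a b) s‖ ≤ C * (t - s) ^ 2 := by
  have hud : UniqueDiffOn ℝ (Icc a b) := uniqueDiffOn_Icc hγ.lt
  have h1 : ContDiffOn ℝ 1 (derivWithin γ (Icc a b)) (Icc a b) :=
    hγ.contDiffOn.derivWithin hud (by norm_cast)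
  obtain ⟨K, hK⟩ := h1.exists_lipschitzOnWith one_ne_zero (convex_Icc a b) isCompact_Icc
  have hL : ∀ s ∈ Icc a b, ∀ t ∈ Icc a b,
      ‖derivWithin γ (Icc a b) t - derivWithin γ (Icc a b) s‖ ≤ (K + 1) * |t - s| := by
    intro s hs t ht
    have := hK.norm_sub_le ht hs
    rw [Real.norm_eq_abs] at this
    nlinarith [abs_nonneg (t - s)]
  refine ⟨K + 1, by positivity, fun s hs t ht => ⟨hL s hs t ht, ?_⟩⟩
  have hsub : uIcc s t ⊆ Icc a b := ordConnected_Icc.uIcc_subset hs ht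
  have hd : ∀ r ∈ uIcc s t, HasDerivWithinAt (fun r => γ r - r • derivWithin γ (Icc a b) s)
      (derivWithin γ (Icc a b) r - (1 : ℝ) • derivWithin γ (Icc a b) s) (uIcc s t) r := by
    intro r hr
    have h2 : HasDerivWithinAt γ (derivWithin γ (Icc a b) r) (uIcc s t) r :=
      ((hγ.contDiffOn.differentiableOn (by simp) r (hsub hr)).hasDerivWithinAt).mono hsub
    exact h2.sub ((hasDerivWithinAt_id r _).smul_const _)
  have := Convex.norm_image_sub_le_of_norm_hasDerivWithin_le (C := (K + 1) * |t - s|) hd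
    (fun r hr => by
      rw [one_smul]
      refine (hL s hs r (hsub hr)).trans ?_
      have : |r - s| ≤ |t - s| := abs_sub_left_of_mem_uIcc hr
      gcongr) (convex_uIcc s t) left_mem_uIcc right_mem_uIcc
  have e : γ t - γ s - (t - s) • derivWithin γ (Icc a b) s
      = γ t - t • derivWithin γ (Icc a b) s - (γ s - s • derivWithin γ (Icc a b) s) := by
    rw [sub_smul]; abel
  rw [e]
  refine this.trans_eq ?_
  rw [Real.norm_eq_abs, mul_assoc, abs_mul_abs_self, sq]

/-- First-order expansion of a closed curve, with parameters taken modulo the period. -/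
theorem exists_periodic_taylor_bound (hγ : IsSmoothSimpleClosedCurve γ a b) :
    ∃ C > 0, ∀ s ∈ Icc a b, ∀ t ∈ Icc a b, ∀ τ : ℝ,
      (τ = t - s ∨ τ = t - s - (b - a) ∨ τ = t - s + (b - a)) →
      ‖derivWithin γ (Icc a b) t - derivWithin γ (Icc a b) s‖ ≤ C * |τ| ∧
        ‖γ t - γ s - τ • derivWithin γ (Icc a b) s‖ ≤ C * τ ^ 2 := by
  obtain ⟨C, hC, h⟩ := hγ.exists_taylor_bound
  have ha : a ∈ Icc a b := left_mem_Icc.2 hγ.lt.le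
  have hb : b ∈ Icc a b := right_mem_Icc.2 hγ.lt.le
  set γ' := derivWithin γ (Icc a b) with hγ'
  have hcl : γ' a = γ' b := hγ.deriv_closed
  -- Going from `s` to `t` through the junction: `p` and `q` are the two end points, where the curve
  -- and its velocity agree. The condition on absolute values says that the two legs run in the same
  -- direction, so each is controlled by the total displacement.
  have key : ∀ s ∈ Icc a b, ∀ t ∈ Icc a b, ∀ p ∈ Icc a b, ∀ q ∈ Icc a b, γ p = γ q → γ' p = γ' q →
      |t - p - (s - q)| = |t - p| + |s - q| →
      ‖γ' t - γ' s‖ ≤ 3 * C * |t - p - (s - q)| ∧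
        ‖γ t - γ s - (t - p - (s - q)) • γ' s‖ ≤ 3 * C * (t - p - (s - q)) ^ 2 := by
    intro s hs t ht p hp q hq hpq hpq' habs
    obtain ⟨h1, h2⟩ := h p hp t ht
    obtain ⟨h3, h4⟩ := h q hq s hs
    constructor
    · have e : γ' t - γ' s = (γ' t - γ' p) - (γ' s - γ' q) := by rw [hpq']; abel
      rw [e, habs]
      refine (norm_sub_le _ _).trans ?_
      nlinarith [mul_nonneg hC.le (abs_nonneg (t - p)), mul_nonneg hC.le (abs_nonneg (s - q))]
    · have e : γ t - γ s - (t - p - (s - q)) • γ' s = (γ t - γ p - (t - p) • γ' p)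
          - (γ s - γ q - (s - q) • γ' q) - (t - p - (s - q)) • (γ' s - γ' q) := by
        rw [hpq', hpq]; module
      rw [e]
      refine (norm_sub_le _ _).trans ((add_le_add_left (norm_sub_le _ _) _).trans ?_)
      rw [norm_smul, Real.norm_eq_abs]
      have h5 : |t - p - (s - q)| * ‖γ' s - γ' q‖ ≤
          |t - p - (s - q)| * (C * |s - q|) := by gcongr
      rw [← sq_abs (t - p - (s - q)), habs] at *
      rw [← sq_abs] at h2 h4
      nlinarith [mul_nonneg hC.le (sq_nonneg (|t - p|)), mul_nonneg hC.le (sq_nonneg (|s - q|)),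
        mul_nonneg hC.le (mul_nonneg (abs_nonneg (t - p)) (abs_nonneg (s - q)))]
  refine ⟨3 * C, by positivity, ?_⟩
  rintro s hs t ht τ (rfl | rfl | rfl)
  · obtain ⟨h1, h2⟩ := h s hs t ht
    refine ⟨h1.trans ?_, h2.trans ?_⟩
    · nlinarith [mul_nonneg hC.le (abs_nonneg (t - s))]
    · nlinarith [mul_nonneg hC.le (sq_nonneg (t - s))]
  · have := key s hs t ht b hb a ha hγ.closed.symm hcl.symm (by
      rw [abs_of_nonpos (by linarith [ht.2] : t - b ≤ 0),
        abs_of_nonneg (by linarith [hs.1] : 0 ≤ s - a),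
        abs_of_nonpos (by linarith [ht.2, hs.1])]; ring)
    convert this using 3 <;> ring_nf
  · have := key s hs t ht a ha b hb hγ.closed hcl (by
      rw [abs_of_nonneg (by linarith [ht.1] : 0 ≤ t - a),
        abs_of_nonpos (by linarith [hs.2] : s - b ≤ 0),
        abs_of_nonneg (by linarith [ht.1, hs.2])]; ring)
    convert this using 3 <;> ring_nf

/-- Points of the curve that are close in space have close parameters modulo the period. -/
theorem exists_close_parameter (hγ : IsSmoothSimpleClosedCurve γ a b) {δ₁ : ℝ} (hδ₁ : 0 < δ₁) :
    ∃ δ > 0, ∀ s ∈ Icc a b, ∀ t ∈ Icc a b, ‖γ t - γ s‖ < δ →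
      ∃ τ : ℝ, (τ = t - s ∨ τ = t - s - (b - a) ∨ τ = t - s + (b - a)) ∧ |τ| < δ₁ := by
  -- Pairs at distance at least `δ₁` modulo the period form a compact set, on which the chord length
  -- is positive by injectivity; its minimum is the required `δ`.
  set S : Set (ℝ × ℝ) := (Icc a b ×ˢ Icc a b) ∩ {q | δ₁ ≤ |q.2 - q.1| ∧
    δ₁ ≤ |q.2 - q.1 - (b - a)| ∧ δ₁ ≤ |q.2 - q.1 + (b - a)|} with hS
  have hSc : IsCompact S := by
    refine (isCompact_Icc.prod isCompact_Icc).inter_right ?_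
    simp only [ofPred_and]
    exact (isClosed_le (by fun_prop) (by fun_prop)).inter
      ((isClosed_le (by fun_prop) (by fun_prop)).inter (isClosed_le (by fun_prop) (by fun_prop)))
  have hcont : ContinuousOn (fun q : ℝ × ℝ => ‖γ q.2 - γ q.1‖) S := by
    have hc := hγ.contDiffOn.continuousOn
    refine ((hc.comp continuousOn_snd fun q hq => hq.1.2).sub
      (hc.comp continuousOn_fst fun q hq => hq.1.1)).norm
  have hpos : ∀ q ∈ S, 0 < ‖γ q.2 - γ q.1‖ := by
    rintro ⟨s, t⟩ ⟨⟨hs, ht⟩, h1, h2, h3⟩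
    simp only at hs ht h1 h2 h3 ⊢
    rw [norm_pos_iff, sub_ne_zero]
    intro heq
    have aux : ∀ x y : ℝ, x = y → δ₁ ≤ |x - y| → False := by
      intro x y hxy h
      rw [hxy, sub_self, abs_zero] at h
      linarith
    rcases hs.2.lt_or_eq with hsb | rfl
    · rcases ht.2.lt_or_eq with htb | rfl
      · exact aux t s (hγ.injOn ⟨ht.1, htb⟩ ⟨hs.1, hsb⟩ heq) h1
      · rw [← hγ.closed] at heq
        have := hγ.injOn ⟨le_rfl, hγ.lt⟩ ⟨hs.1, hsb⟩ heq
        exact aux _ _ (by rw [this]) h2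
    · rcases ht.2.lt_or_eq with htb | rfl
      · rw [← hγ.closed] at heq
        have := hγ.injOn ⟨ht.1, htb⟩ ⟨le_rfl, hγ.lt⟩ heq
        refine aux (t - s + s) a (by linarith) ?_
        convert h3 using 2; ring
      · exact aux _ _ rfl h1
  obtain ⟨δ, hδ, h⟩ : ∃ δ > 0, ∀ q ∈ S, δ ≤ ‖γ q.2 - γ q.1‖ := by
    rcases S.eq_empty_or_nonempty with he | hne
    · exact ⟨1, one_pos, by simp [he]⟩
    · obtain ⟨q, hq, hmin⟩ := hSc.exists_isMinOn hne hcont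
      exact ⟨_, hpos q hq, fun q' hq' => hmin hq'⟩
  refine ⟨δ, hδ, fun s hs t ht hst => ?_⟩
  by_contra! hcon
  exact absurd (h (s, t) ⟨⟨hs, ht⟩, hcon _ (Or.inl rfl), hcon _ (Or.inr (Or.inl rfl)),
    hcon _ (Or.inr (Or.inr rfl))⟩) (not_le.2 hst)

theorem exists_speed_lower_bound (hγ : IsSmoothSimpleClosedCurve γ a b) :
    ∃ m > 0, ∀ t ∈ Icc a b, m ≤ ‖derivWithin γ (Icc a b) t‖ := by
  have hc : ContinuousOn (fun t => ‖derivWithin γ (Icc a b) t‖) (Icc a b) :=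
    (hγ.contDiffOn.continuousOn_derivWithin (uniqueDiffOn_Icc hγ.lt) (by norm_cast)).norm
  obtain ⟨t, ht, hmin⟩ := isCompact_Icc.exists_isMinOn ⟨a, left_mem_Icc.2 hγ.lt.le⟩ hc
  exact ⟨_, norm_pos_iff.2 (hγ.deriv_ne_zero t ht), fun s hs => hmin hs⟩

/-- Converts parameter distance into chord length: for nearby points the speed bound makes `|τ|` at
most a multiple of the chord, so the Taylor errors can be expressed without parameters. -/
theorem exists_chord_bound (hγ : IsSmoothSimpleClosedCurve γ a b) :
    ∃ K > 0, ∃ δ > 0, ∀ s ∈ Icc a b, ∀ t ∈ Icc a b, ‖γ t - γ s‖ < δ →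
      ‖derivWithin γ (Icc a b) t - derivWithin γ (Icc a b) s‖ ≤ K * ‖γ t - γ s‖ ∧
        ∃ τ : ℝ, ‖γ t - γ s - τ • derivWithin γ (Icc a b) s‖ ≤ K * ‖γ t - γ s‖ ^ 2 := by
  obtain ⟨C, hC, hT⟩ := hγ.exists_periodic_taylor_bound
  obtain ⟨m, hm, hspeed⟩ := hγ.exists_speed_lower_bound
  -- With `|τ| < m / (2C)` the quadratic error `C τ²` is at most `m|τ|/2` and is absorbed by the
  -- linear term.
  obtain ⟨δ, hδ, hclose⟩ := hγ.exists_close_parameter (δ₁ := m / (2 * C)) (by positivity)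
  refine ⟨max (C * (2 / m)) (C * (2 / m) ^ 2), by positivity, δ, hδ, fun s hs t ht hst => ?_⟩
  obtain ⟨τ, hτ, hτδ⟩ := hclose s hs t ht hst
  obtain ⟨h1, h2⟩ := hT s hs t ht τ hτ
  have h3 : |τ| * m ≤ ‖γ t - γ s‖ + C * τ ^ 2 := by
    have : ‖τ • derivWithin γ (Icc a b) s‖ ≤ ‖γ t - γ s‖ + C * τ ^ 2 := by
      have e : τ • derivWithin γ (Icc a b) s
        = (γ t - γ s) - (γ t - γ s - τ • derivWithin γ (Icc a b) s) := by abel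
      rw [e]
      exact (norm_sub_le _ _).trans (by gcongr)
    rw [norm_smul, Real.norm_eq_abs] at this
    exact (mul_le_mul_of_nonneg_left (hspeed s hs) (abs_nonneg τ)).trans this
  have h4 : |τ| ≤ 2 / m * ‖γ t - γ s‖ := by
    rw [lt_div_iff₀ (by positivity)] at hτδ
    rw [← sq_abs] at h3
    rw [div_mul_eq_mul_div, le_div_iff₀ hm]
    nlinarith [abs_nonneg τ]
  have h5 : τ ^ 2 ≤ (2 / m) ^ 2 * ‖γ t - γ s‖ ^ 2 := by
    rw [← sq_abs, ← mul_pow]; gcongr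
  refine ⟨h1.trans ?_, τ, h2.trans ?_⟩
  · calc C * |τ| ≤ C * (2 / m * ‖γ t - γ s‖) := by gcongr
      _ = C * (2 / m) * ‖γ t - γ s‖ := by ring
      _ ≤ _ := by gcongr; exact le_max_left _ _
  · calc C * τ ^ 2 ≤ C * ((2 / m) ^ 2 * ‖γ t - γ s‖ ^ 2) := by gcongr
      _ = C * (2 / m) ^ 2 * ‖γ t - γ s‖ ^ 2 := by ring
      _ ≤ _ := by gcongr; exact le_max_right _ _

/-- At a nearest point, the connecting segment is normal to the curve. -/
theorem inner_deriv_eq_zero_of_nearest (hγ : IsSmoothSimpleClosedCurve γ a b)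
    {x : EuclideanSpace ℝ (Fin n)} {t : ℝ} (ht : t ∈ Icc a b)
    (hmin : ∀ s ∈ Icc a b, ‖x - γ t‖ ≤ ‖x - γ s‖) :
    inner ℝ (x - γ t) (derivWithin γ (Icc a b) t) = 0 := by
  obtain ⟨C, hC, hT⟩ := hγ.exists_periodic_taylor_bound
  set D := derivWithin γ (Icc a b) t
  set c : ℝ := inner ℝ (x - γ t) D with hc
  set L := min (b - a) 1 with hL
  have hLpos : 0 < L := lt_min (sub_pos.2 hγ.lt) one_pos
  set B := (‖D‖ + C) ^ 2 + 2 * ‖x - γ t‖ * C + 1 with hB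
  have hBpos : 0 < B := by positivity
  -- First-order condition at the minimum. Shifts by `τ` of either sign are allowed, wrapping around
  -- at the end points; taking `τ = θc` with small `θ > 0` then forces `c = 0`.
  have key : ∀ τ : ℝ, |τ| ≤ L → 2 * (τ * c) ≤ B * τ ^ 2 := by
    intro τ hτ
    have hτ1 : |τ| ≤ b - a := hτ.trans (min_le_left _ _)
    have hτ2 : |τ| ≤ 1 := hτ.trans (min_le_right _ _)
    obtain ⟨s, hs, hsτ⟩ : ∃ s ∈ Icc a b,
        (τ = s - t ∨ τ = s - t - (b - a) ∨ τ = s - t + (b - a)) := by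
      rcases abs_le.1 hτ1 with ⟨h1, h2⟩
      by_cases h3 : t + τ < a
      · exact ⟨t + τ + (b - a), ⟨by linarith [ht.1], by linarith⟩, Or.inr (Or.inl (by ring))⟩
      · by_cases h4 : b < t + τ
        · exact ⟨t + τ - (b - a), ⟨by linarith, by linarith [ht.2]⟩, Or.inr (Or.inr (by ring))⟩
        · exact ⟨t + τ, ⟨by linarith, by linarith⟩, Or.inl (by ring)⟩
    have h2 := (hT t ht s hs τ hsτ).2
    have h1 := hmin s hs
    have e : x - γ s = (x - γ t) - (γ s - γ t) := by abel
    have h3 : 2 * inner ℝ (x - γ t) (γ s - γ t) ≤ ‖γ s - γ t‖ ^ 2 := by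
      have := norm_sub_sq_real (x - γ t) (γ s - γ t)
      rw [← e] at this
      have h' : ‖x - γ t‖ ^ 2 ≤ ‖x - γ s‖ ^ 2 := by gcongr
      linarith
    set r := γ s - γ t - τ • D with hr
    have e2 : γ s - γ t = τ • D + r := by rw [hr]; abel
    have hn : ‖γ s - γ t‖ ≤ |τ| * (‖D‖ + C) := by
      rw [e2]
      refine (norm_add_le _ _).trans ?_
      rw [norm_smul, Real.norm_eq_abs]
      rw [← sq_abs] at h2
      nlinarith [abs_nonneg τ, mul_nonneg hC.le (abs_nonneg τ)]
    have hn2 : ‖γ s - γ t‖ ^ 2 ≤ τ ^ 2 * (‖D‖ + C) ^ 2 := by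
      rw [← sq_abs τ, ← mul_pow]; gcongr
    have hri : -(‖x - γ t‖ * (C * τ ^ 2)) ≤ inner ℝ (x - γ t) r := by
      have := abs_le.1 (abs_real_inner_le_norm (x - γ t) r)
      have h6 : ‖x - γ t‖ * ‖r‖ ≤ ‖x - γ t‖ * (C * τ ^ 2) := by gcongr
      linarith [this.1]
    have e3 : inner ℝ (x - γ t) (γ s - γ t) = τ * c + inner ℝ (x - γ t) r := by
      rw [e2, inner_add_right, real_inner_smul_right]
    rw [e3] at h3
    nlinarith [sq_nonneg τ]
  by_contra hne
  have hc0 : 0 < |c| := abs_pos.2 hne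
  set θ := min (1 / B) (L / |c|) with hθ
  have hθpos : 0 < θ := lt_min (by positivity) (by positivity)
  have h1 := key (θ * c) (by
    rw [abs_mul, abs_of_pos hθpos]
    calc θ * |c| ≤ L / |c| * |c| := by gcongr; exact min_le_right _ _
      _ = L := by field_simp)
  have h2 : B * θ ≤ 1 := by
    calc B * θ ≤ B * (1 / B) := by gcongr; exact min_le_left _ _
      _ = 1 := by field_simp
  have h3 : 0 < θ * c ^ 2 := by positivity
  nlinarith

/-- Near a regular simple closed curve, a nearest-point map is, up to a small relative error,
locally the orthogonal projection onto the tangent line. -/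
theorem exists_nearest_point_map (hγ : IsSmoothSimpleClosedCurve γ a b) {κ : ℝ} (hκ : 0 < κ) :
    ∃ ε₀ > 0, ∃ P T : EuclideanSpace ℝ (Fin n) → EuclideanSpace ℝ (Fin n),
      (∀ x, P x ∈ γ '' Icc a b ∧ ‖x - P x‖ = Metric.infDist x (γ '' Icc a b)) ∧
      (∀ x, ‖T x‖ = 1) ∧
      ∀ x y, Metric.infDist x (γ '' Icc a b) < ε₀ → Metric.infDist y (γ '' Icc a b) < ε₀ →
        ‖y - x‖ < ε₀ → ‖P y - P x - inner ℝ (y - x) (T x) • T x‖ ≤ κ * ‖y - x‖ := by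
  obtain ⟨K, hK, δ, hδ, hchord⟩ := hγ.exists_chord_bound
  obtain ⟨m, hm, hspeed⟩ := hγ.exists_speed_lower_bound
  have hcpt : IsCompact (γ '' Icc a b) := isCompact_Icc.image_of_continuousOn
    hγ.contDiffOn.continuousOn
  have hne : (γ '' Icc a b).Nonempty := (nonempty_Icc.2 hγ.lt.le).image _
  have hex : ∀ x, ∃ t ∈ Icc a b, ‖x - γ t‖ = Metric.infDist x (γ '' Icc a b) := by
    intro x
    obtain ⟨_, ⟨t, ht, rfl⟩, h⟩ := hcpt.exists_infDist_eq_dist hne x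
    exact ⟨t, ht, by rw [h, dist_eq_norm]⟩
  choose p hp hpd using hex
  set γ' := derivWithin γ (Icc a b) with hγ'
  have horth : ∀ x, inner ℝ (x - γ (p x)) (γ' (p x)) = 0 := fun x =>
    hγ.inner_deriv_eq_zero_of_nearest (hp x) fun s hs => by
      rw [hpd, ← dist_eq_norm]
      exact Metric.infDist_le_dist_of_mem (mem_image_of_mem _ hs)
  -- `3K` comes from the chord estimate, using `‖Δ‖ < 3ε₀`, and `K / m` from the turning of the
  -- tangent between the two feet. Below, `Q ε₀ ≤ 1/2` yields `‖Δ‖ ≤ 2‖y - x‖`, and `Q ε₀ ≤ κ/2`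
  -- then yields the final constant.
  set Q := 3 * K + K / m with hQ
  have hQpos : 0 < Q := by positivity
  set ε₀ := min (δ / 3) (min (κ / 2) (1 / 2) / Q) with hε₀
  have hε₀pos : 0 < ε₀ := by positivity
  have hε1 : 3 * ε₀ ≤ δ := by
    have : ε₀ ≤ δ / 3 := min_le_left _ _
    linarith
  have hε2 : Q * ε₀ ≤ min (κ / 2) (1 / 2) := by
    have : ε₀ ≤ min (κ / 2) (1 / 2) / Q := min_le_right _ _
    rwa [le_div_iff₀ hQpos, mul_comm] at this
  refine ⟨ε₀, hε₀pos, fun x => γ (p x), fun x => ‖γ' (p x)‖⁻¹ • γ' (p x),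
    fun x => ⟨mem_image_of_mem _ (hp x), hpd x⟩, fun x => ?_, fun x y hx hy hxy => ?_⟩
  · rw [norm_smul, norm_inv, norm_norm, inv_mul_cancel₀]
    exact norm_ne_zero_iff.2 (hγ.deriv_ne_zero _ (hp x))
  simp only
  set T := ‖γ' (p x)‖⁻¹ • γ' (p x) with hT
  have hDpos : 0 < ‖γ' (p x)‖ := norm_pos_iff.2 (hγ.deriv_ne_zero _ (hp x))
  have hT1 : ‖T‖ = 1 := by
    rw [hT, norm_smul, norm_inv, norm_norm, inv_mul_cancel₀ hDpos.ne']
  set Δ := γ (p y) - γ (p x) with hΔ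
  set v := x - γ (p x) with hv
  set w := y - γ (p y) with hw
  have hsplit : Δ = (y - x) - w + v := by rw [hΔ, hv, hw]; abel
  rw [← hpd] at hx hy
  have hΔδ : ‖Δ‖ < 3 * ε₀ := by
    rw [hsplit]
    have h1 := norm_add_le ((y - x) - w) v
    have h2 := norm_sub_le (y - x) w
    linarith
  obtain ⟨hd, τ, hτ⟩ := hchord (p x) (hp x) (p y) (hp y) (hΔδ.trans_le hε1)
  rw [← hΔ] at hd hτ
  have hvT : inner ℝ v T = 0 := by rw [hT, real_inner_smul_right, horth, mul_zero]
  -- `w` is normal at the foot of `y`, so only the change of velocity between the feet contributes.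
  have hwT : |inner ℝ w T| ≤ K / m * ε₀ * ‖Δ‖ := by
    have e : inner ℝ w (γ' (p x)) = - inner ℝ w (γ' (p y) - γ' (p x)) := by
      rw [inner_sub_right, horth y]; ring
    rw [hT, real_inner_smul_right, e, abs_mul, abs_neg, abs_of_pos (inv_pos.2 hDpos)]
    have h1 : |inner ℝ w (γ' (p y) - γ' (p x))| ≤ ε₀ * (K * ‖Δ‖) :=
      (abs_real_inner_le_norm _ _).trans (by gcongr)
    have h2 : ‖γ' (p x)‖⁻¹ ≤ m⁻¹ := inv_anti₀ hm (hspeed _ (hp x))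
    calc _ ≤ m⁻¹ * (ε₀ * (K * ‖Δ‖)) := by gcongr
      _ = _ := by ring
  have hproj : ‖Δ - inner ℝ Δ T • T‖ ≤ K * (3 * ε₀) * ‖Δ‖ := by
    -- The orthogonal projection is the best approximation on the tangent line, so the unknown `τ`
    -- may be replaced.
    have hle : ‖Δ - inner ℝ Δ T • T‖ ≤ ‖Δ - τ • γ' (p x)‖ := by
      have e : τ • γ' (p x) = (τ * ‖γ' (p x)‖) • T := by
        rw [hT, smul_smul, mul_assoc, mul_inv_cancel₀ hDpos.ne', mul_one]
      rw [e]
      set c := τ * ‖γ' (p x)‖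
      refine (sq_le_sq₀ (norm_nonneg _) (norm_nonneg _)).1 ?_
      have hexp : ∀ d : ℝ, ‖Δ - d • T‖ ^ 2 = ‖Δ‖ ^ 2 - 2 * (d * inner ℝ Δ T) + d ^ 2 := by
        intro d
        rw [norm_sub_sq_real, real_inner_smul_right, norm_smul, hT1, mul_one, Real.norm_eq_abs,
          sq_abs]
      rw [hexp, hexp]
      nlinarith [sq_nonneg (c - inner ℝ Δ T)]
    refine hle.trans (hτ.trans ?_)
    rw [sq]
    have := norm_nonneg Δ
    calc K * (‖Δ‖ * ‖Δ‖) ≤ K * (3 * ε₀ * ‖Δ‖) := by gcongr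
      _ = _ := by ring
  have e : Δ - inner ℝ (y - x) T • T = (Δ - inner ℝ Δ T • T) - inner ℝ w T • T := by
    have : y - x = Δ + w - v := by rw [hsplit]; abel
    rw [this, inner_sub_left, inner_add_left, hvT]
    module
  have hmain : ‖Δ - inner ℝ (y - x) T • T‖ ≤ Q * ε₀ * ‖Δ‖ := by
    rw [e]
    refine (norm_sub_le _ _).trans ?_
    rw [norm_smul, hT1, mul_one, Real.norm_eq_abs, hQ]
    nlinarith
  have hΔ2 : ‖Δ‖ ≤ 2 * ‖y - x‖ := by
    have h1 : ‖Δ‖ ≤ ‖Δ - inner ℝ (y - x) T • T‖ + ‖inner ℝ (y - x) T • T‖ := by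
      simpa using norm_add_le (Δ - inner ℝ (y - x) T • T) (inner ℝ (y - x) T • T)
    have h2 : ‖inner ℝ (y - x) T • T‖ ≤ ‖y - x‖ := by
      rw [norm_smul, hT1, mul_one]
      simpa [hT1] using abs_real_inner_le_norm (y - x) T
    have h3 : Q * ε₀ * ‖Δ‖ ≤ 1 / 2 * ‖Δ‖ := by
      gcongr; exact hε2.trans (min_le_right _ _)
    linarith
  calc _ ≤ Q * ε₀ * ‖Δ‖ := hmain
    _ ≤ κ / 2 * (2 * ‖y - x‖) := by
        gcongr
        exact hε2.trans (min_le_left _ _)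
    _ = κ * ‖y - x‖ := by ring

end IsSmoothSimpleClosedCurve

/-! ### Mollification and the outward vector field. -/

open Filter Topology Metric in
-- Passes a one-sided bound on increments to the derivative. The finite sum covers both uses: one
-- direction for the quadratic form, an orthonormal basis for the trace.
theorem sum_inner_fderiv_le {E ι : Type*} [NormedAddCommGroup E] [InnerProductSpace ℝ E]
    [Fintype ι] {W : E → E} {x : E} (hW : DifferentiableAt ℝ W x) (h k : ι → E) {c : ℝ}
    (hc : ∀ᶠ t : ℝ in 𝓝[>] 0, ∑ j, inner ℝ (W (x + t • h j) - W x) (k j) ≤ t * c) :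
    ∑ j, inner ℝ (fderiv ℝ W x (h j)) (k j) ≤ c := by
  have hlim : Tendsto (fun t : ℝ => ∑ j, inner ℝ (t⁻¹ • (W (x + t • h j) - W x)) (k j)) (𝓝[>] 0)
      (𝓝 (∑ j, inner ℝ (fderiv ℝ W x (h j)) (k j))) := by
    refine tendsto_finsetSum _ fun j _ => ?_
    have h1 : HasLineDerivAt ℝ W (fderiv ℝ W x (h j)) x (h j) := hW.hasFDerivAt.hasLineDerivAt _
    exact (h1.tendsto_slope_zero_right).inner tendsto_const_nhds
  refine le_of_tendsto hlim ?_
  filter_upwards [hc, self_mem_nhdsWithin] with t ht ht0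
  have ht0 : 0 < t := ht0
  simp_rw [real_inner_smul_left]
  rw [← Finset.mul_sum, inv_mul_le_iff₀ ht0]
  exact ht

open Metric in
-- A mollification is an average of translates with weights of total mass one, so linear bounds on
-- increments survive, even for a non-differentiable field.
theorem sum_inner_convolution_sub_le {E ι : Type*} [NormedAddCommGroup E] [InnerProductSpace ℝ E]
    [FiniteDimensional ℝ E] [MeasurableSpace E] [BorelSpace E] [Fintype ι]
    (φ : ContDiffBump (0 : E)) {V : E → E} (hV : LocallyIntegrable V volume) {x : E}
    (h k : ι → E) {c : ℝ}
    (hc : ∀ y ∈ ball x φ.rOut, ∑ j, inner ℝ (V (y + h j) - V y) (k j) ≤ c) :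
    ∑ j, inner ℝ (convolution (φ.normed volume) V (ContinuousLinearMap.lsmul ℝ ℝ) volume (x + h j)
      - convolution (φ.normed volume) V (ContinuousLinearMap.lsmul ℝ ℝ) volume x) (k j) ≤ c := by
  have hint : ∀ x, Integrable (fun z => φ.normed volume z • V (x - z)) volume := fun x =>
    φ.hasCompactSupport_normed.convolutionExists_left (ContinuousLinearMap.lsmul ℝ ℝ)
      φ.continuous_normed hV x
  simp only [convolution, ContinuousLinearMap.lsmul_apply]
  have e : ∀ j, inner ℝ ((∫ z, φ.normed volume z • V (x + h j - z))
      - ∫ z, φ.normed volume z • V (x - z)) (k j) =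
      ∫ z, φ.normed volume z * inner ℝ (V (x - z + h j) - V (x - z)) (k j) := by
    intro j
    rw [← integral_sub (hint _) (hint _), real_inner_comm]
    refine (integral_inner ((hint (x + h j)).sub (hint x)) (k j)).symm.trans ?_
    congr 1; ext z
    rw [Pi.sub_apply, ← smul_sub, real_inner_smul_right, real_inner_comm, add_sub_right_comm]
  simp_rw [e]
  have hint2 : ∀ j, Integrable
      (fun z => φ.normed volume z * inner ℝ (V (x - z + h j) - V (x - z)) (k j)) volume := by
    intro j
    refine (((hint (x + h j)).sub (hint x)).inner_const (k j)).congr (ae_of_all _ fun z => ?_)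
    simp only [Pi.sub_apply]
    rw [← smul_sub, real_inner_smul_left, add_sub_right_comm]
  rw [← integral_finsetSum _ fun j _ => hint2 j]
  calc _ ≤ ∫ z, φ.normed volume z * c := by
        refine integral_mono (integrable_finsetSum _ fun j _ => hint2 j)
          (φ.integrable_normed.mul_const c) fun z => ?_
        simp only
        rw [← Finset.mul_sum]
        by_cases hz : z ∈ ball (0 : E) φ.rOut
        · refine mul_le_mul_of_nonneg_left (hc _ ?_) (φ.nonneg_normed z)
          simpa [mem_ball, dist_eq_norm] using hz
        · have : φ.normed volume z = 0 := by
            rw [← Function.notMem_support, φ.support_normed_eq]; exact hz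
          simp [this]
    _ = c := by rw [integral_mul_const, φ.integral_normed, one_mul]

open Metric Filter Topology in
/-- A smooth vector field close to `x - P x`, where `P` is a nearest-point map onto a curve:
its derivative is nearly the projection onto the normal space, and its flow points out of the
tube. -/
theorem exists_outward_field {E : Type*} [NormedAddCommGroup E] [InnerProductSpace ℝ E]
    [FiniteDimensional ℝ E] [MeasurableSpace E] [BorelSpace E] {Γ : Set (E)} (hΓ : IsCompact Γ)
    {ε₀ κ : ℝ} (hκ1 : κ ≤ 1)
    {P T : E → E}
    (hP : ∀ x, P x ∈ Γ ∧ ‖x - P x‖ = infDist x Γ) (hT : ∀ x, ‖T x‖ = 1)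
    (hPT : ∀ x y, infDist x Γ < ε₀ → infDist y Γ < ε₀ → ‖y - x‖ < ε₀ →
      ‖P y - P x - inner ℝ (y - x) (T x) • T x‖ ≤ κ * ‖y - x‖)
    {ε : ℝ} (hε : 0 < ε) (hεε₀ : ε < ε₀) :
    ∃ W : E → E, ContDiff ℝ 1 W ∧
      HasCompactSupport W ∧
      (∀ x ∈ thickening ε Γ, (∀ ξ, inner ℝ (fderiv ℝ W x ξ) ξ ≤ (1 + κ) * ‖ξ‖ ^ 2) ∧
        |LinearMap.trace ℝ _ (fderiv ℝ W x).toLinearMap - (Module.finrank ℝ E - 1)| ≤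
          Module.finrank ℝ E * κ) ∧
      ∀ᶠ s : ℝ in 𝓝[>] 0, ∀ x ∉ thickening ε Γ, x + s • W x ∉ thickening ε Γ := by
  set n := Module.finrank ℝ E
  have hne : Γ.Nonempty := ⟨P 0, (hP 0).1⟩
  have hthick : ∀ δ x, x ∈ thickening δ Γ ↔ infDist x Γ < δ := fun δ x => by
    rw [mem_thickening_iff, infDist_lt_iff hne]
  set V : E → E := fun x => x - P x with hV
  have hVn : ∀ x, ‖V x‖ = infDist x Γ := fun x => (hP x).2
  have hVlip : ∀ x y, infDist x Γ < ε₀ → infDist y Γ < ε₀ → ‖y - x‖ < ε₀ →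
      ‖V y - V x‖ ≤ 3 * ‖y - x‖ := by
    intro x y hx hy hxy
    have e : V y - V x = (y - x) - inner ℝ (y - x) (T x) • T x
      - (P y - P x - inner ℝ (y - x) (T x) • T x) := by simp only [hV]; abel
    have h1 : ‖inner ℝ (y - x) (T x) • T x‖ ≤ ‖y - x‖ := by
      rw [norm_smul, hT, mul_one]
      simpa [hT] using abs_real_inner_le_norm (y - x) (T x)
    have h2 := hPT x y hx hy hxy
    have h3 : κ * ‖y - x‖ ≤ 1 * ‖y - x‖ := by gcongr
    rw [e]
    have h4 := norm_sub_le ((y - x) - inner ℝ (y - x) (T x) • T x)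
      (P y - P x - inner ℝ (y - x) (T x) • T x)
    have h5 := norm_sub_le (y - x) (inner ℝ (y - x) (T x) • T x)
    linarith
  have hVd : ∀ y, infDist y Γ < ε₀ → ∀ h k : E, infDist (y + h) Γ < ε₀ → ‖h‖ < ε₀ →
      |inner ℝ (V (y + h) - V y) k - (inner ℝ h k - inner ℝ h (T y) * inner ℝ (T y) k)|
        ≤ κ * ‖h‖ * ‖k‖ := by
    intro y hy h k hyh hh
    have h1 := hPT y (y + h) hy hyh (by simpa using hh)
    rw [add_sub_cancel_left] at h1
    have e : inner ℝ (V (y + h) - V y) k - (inner ℝ h k - inner ℝ h (T y) * inner ℝ (T y) k)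
        = - inner ℝ (P (y + h) - P y - inner ℝ h (T y) • T y) k := by
      simp only [hV, inner_sub_left, inner_add_left, real_inner_smul_left]; ring
    rw [e, abs_neg]
    exact (abs_real_inner_le_norm _ _).trans (by gcongr)
  set U := thickening ε₀ Γ with hU
  have hUo : IsOpen U := isOpen_thickening
  have hε₀ : 0 < ε₀ := hε.trans hεε₀
  have hVc : ContinuousOn V U := by
    rw [Metric.continuousOn_iff]
    intro x hx δ hδ
    refine ⟨min ε₀ (δ / 3), by positivity, fun y hy hyx => ?_⟩
    rw [dist_eq_norm] at hyx ⊢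
    have h1 := hVlip x y ((hthick _ _).1 hx) ((hthick _ _).1 hy)
      (hyx.trans_le (min_le_left _ _))
    have h2 := hyx.trans_le (min_le_right _ _)
    linarith
  set V₀ : E → E := U.indicator V with hV₀
  have hV₀eq : ∀ x, infDist x Γ < ε₀ → V₀ x = V x := fun x hx =>
    indicator_of_mem ((hthick _ _).2 hx) V
  have hUb : Bornology.IsBounded U := hΓ.isBounded.thickening
  have hVint : Integrable V₀ volume := by
    rw [hV₀, integrable_indicator_iff hUo.measurableSet]
    refine IntegrableOn.of_bound hUb.measure_lt_top
      (hVc.aestronglyMeasurable hUo.measurableSet) ε₀ ?_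
    filter_upwards [ae_restrict_mem hUo.measurableSet] with x hx
    rw [hVn]; exact ((hthick _ _).1 hx).le
  have hV₀supp : HasCompactSupport V₀ := by
    refine HasCompactSupport.of_support_subset_isCompact hUb.isCompact_closure ?_
    exact support_indicator_subset.trans subset_closure
  -- The first bound keeps mollification balls and small increments inside `U`; the second gives `‖W
  -- - V‖ ≤ 3r ≤ ε/2`, hence `⟨V, W⟩ ≥ ‖V‖²/2` at nearby points outside the tube.
  set r := min ((ε₀ - ε) / 4) (ε / 6) with hr
  have hrpos : 0 < r := lt_min (by linarith) (by linarith)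
  have hr1 : r ≤ (ε₀ - ε) / 4 := min_le_left _ _
  have hr2 : r ≤ ε / 6 := min_le_right _ _
  let φ : ContDiffBump (0 : E) := ⟨r / 2, r, by linarith, by linarith⟩
  have hφr : φ.rOut = r := rfl
  set W : E → E := convolution (φ.normed volume) V₀ (ContinuousLinearMap.lsmul ℝ ℝ) volume with hW
  have hWsmooth : ContDiff ℝ 1 W :=
    φ.hasCompactSupport_normed.contDiff_convolution_left (n := 1) (ContinuousLinearMap.lsmul ℝ ℝ)
      φ.contDiff_normed hVint.locallyIntegrable
  have hWsupp : HasCompactSupport W := φ.hasCompactSupport_normed.convolution _ hV₀supp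
  have hinf : ∀ x y : E, infDist y Γ ≤ infDist x Γ + ‖y - x‖ := fun x y => by
    rw [← dist_eq_norm]; exact infDist_le_infDist_add_dist
  have hWV : ∀ x, infDist x Γ + r < ε₀ → ‖W x - V x‖ ≤ 3 * r := by
    intro x hx
    rw [← hV₀eq x (by linarith), ← dist_eq_norm]
    refine φ.dist_normed_convolution_le hVint.aestronglyMeasurable fun y hy => ?_
    rw [hφr, mem_ball, dist_eq_norm] at hy
    have hy' := hinf x y
    rw [hV₀eq x (by linarith), hV₀eq y (by linarith), dist_eq_norm]
    have := hVlip x y (by linarith) (by linarith) (by linarith)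
    linarith
  have hsum : ∀ x, infDist x Γ < ε → ∀ {ι : Type} [Fintype ι] (h k : ι → E) (c : ℝ),
      (∀ᶠ t : ℝ in 𝓝[>] 0, ∀ y, infDist y Γ < ε₀ → (∀ j, infDist (y + t • h j) Γ < ε₀) →
        (∀ j, ‖t • h j‖ < ε₀) → ∑ j, inner ℝ (V (y + t • h j) - V y) (k j) ≤ t * c) →
      ∑ j, inner ℝ (fderiv ℝ W x (h j)) (k j) ≤ c := by
    intro x hx ι _ h k c hc
    refine sum_inner_fderiv_le ((hWsmooth.differentiable (by simp)) x) h k ?_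
    have hsmall : ∀ᶠ t : ℝ in 𝓝[>] 0, ∀ j, ‖t • h j‖ < r := by
      refine eventually_all.2 fun j => ?_
      have : Tendsto (fun t : ℝ => ‖t • h j‖) (𝓝[>] 0) (𝓝 ‖(0 : ℝ) • h j‖) :=
        ((continuous_id.smul continuous_const).norm.tendsto 0).mono_left nhdsWithin_le_nhds
      exact this.eventually_lt_const (by simpa using hrpos)
    filter_upwards [hc, hsmall] with t ht hts
    refine sum_inner_convolution_sub_le φ hVint.locallyIntegrable (fun j => t • h j) k
      fun y hy => ?_
    rw [hφr, mem_ball, dist_eq_norm] at hy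
    have hy' := hinf x y
    have hyj : ∀ j, infDist (y + t • h j) Γ < ε₀ := fun j => by
      have h1 := hinf y (y + t • h j)
      rw [add_sub_cancel_left] at h1
      have := hts j
      linarith
    have h2 := ht y (by linarith) hyj fun j => by have := hts j; linarith
    rw [hV₀eq y (by linarith)]
    simpa only [hV₀eq _ (hyj _)] using h2
  refine ⟨W, hWsmooth, hWsupp, fun x hx => ⟨fun ξ => ?_, ?_⟩, ?_⟩
  · rw [hthick] at hx
    have := hsum x hx (fun _ : Unit => ξ) (fun _ => ξ) ((1 + κ) * ‖ξ‖ ^ 2) ?_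
    · simpa using this
    filter_upwards [self_mem_nhdsWithin] with t ht y hy hyt htξ
    have ht : 0 < t := ht
    have h1 := (abs_le.1 (hVd y hy (t • ξ) ξ (hyt ()) (htξ ()))).2
    rw [norm_smul, Real.norm_eq_abs, abs_of_pos ht, real_inner_smul_left, real_inner_smul_left,
      real_inner_self_eq_norm_sq, real_inner_comm ξ (T y)] at h1
    simp only [Finset.univ_unique, Finset.sum_const, Finset.card_singleton, one_smul]
    nlinarith [mul_nonneg ht.le (sq_nonneg (inner ℝ ξ (T y)))]
  · rw [hthick] at hx
    set e := stdOrthonormalBasis ℝ E with he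
    have htr : LinearMap.trace ℝ _ (fderiv ℝ W x).toLinearMap
        = ∑ i, inner ℝ (fderiv ℝ W x (e i)) (e i) := by
      rw [LinearMap.trace_eq_sum_inner _ e]
      exact Finset.sum_congr rfl fun i _ => real_inner_comm _ _
    have hsq : ∀ y, ∑ i, inner ℝ (e i) (T y) ^ 2 = 1 := fun y => by
      have := e.sum_sq_norm_inner_right (T y)
      simpa [hT] using this
    have hdiff : ∀ t : ℝ, 0 < t → ∀ y, infDist y Γ < ε₀ →
        (∀ j, infDist (y + t • e j) Γ < ε₀) → (∀ j, ‖t • e j‖ < ε₀) →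
        |∑ j, inner ℝ (V (y + t • e j) - V y) (e j) - t * (n - 1)| ≤ t * (n * κ) := by
      intro t ht y hy hyt hte
      have e1 : ∑ j, inner ℝ (V (y + t • e j) - V y) (e j) - t * (n - 1) =
          ∑ j, (inner ℝ (V (y + t • e j) - V y) (e j) -
            (inner ℝ (t • e j) (e j) - inner ℝ (t • e j) (T y) * inner ℝ (T y) (e j))) := by
        rw [Finset.sum_sub_distrib]
        congr 1
        have : ∀ j, inner ℝ (t • e j) (e j) - inner ℝ (t • e j) (T y) * inner ℝ (T y) (e j)
            = t * (1 - inner ℝ (e j) (T y) ^ 2) := fun j => by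
          rw [real_inner_smul_left, real_inner_smul_left, real_inner_self_eq_norm_sq,
            e.norm_eq_one, real_inner_comm (e j) (T y)]; ring
        simp_rw [this]
        rw [← Finset.mul_sum, Finset.sum_sub_distrib, hsq]
        simp [n]
      rw [e1]
      refine (Finset.abs_sum_le_sum_abs _ _).trans ?_
      calc _ ≤ ∑ j : Fin n, κ * t := Finset.sum_le_sum fun j _ => by
            have := hVd y hy (t • e j) (e j) (hyt j) (hte j)
            rwa [norm_smul, e.norm_eq_one, Real.norm_eq_abs, abs_of_pos ht, mul_one, mul_one]
              at this
        _ = _ := by simp [n]; ring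
    rw [htr, abs_le]
    constructor
    · have := hsum x hx (fun j => e j) (fun j => -e j) (-(n - 1) + n * κ) ?_
      · simp only [inner_neg_right, Finset.sum_neg_distrib] at this
        linarith
      filter_upwards [self_mem_nhdsWithin] with t ht y hy hyt hte
      have := (abs_le.1 (hdiff t ht y hy hyt hte)).1
      simp only [inner_neg_right, Finset.sum_neg_distrib]
      linarith
    · have := hsum x hx (fun j => e j) (fun j => e j) ((n - 1) + n * κ) ?_
      · linarith
      filter_upwards [self_mem_nhdsWithin] with t ht y hy hyt hte
      have := (abs_le.1 (hdiff t ht y hy hyt hte)).2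
      linarith
  · obtain ⟨B, hB⟩ := hWsupp.exists_bound_of_continuous hWsmooth.continuous
    have hB0 : 0 ≤ B := (norm_nonneg _).trans (hB 0)
    have hs1 : ∀ᶠ s : ℝ in 𝓝[>] 0, s * B < (ε₀ - ε) / 4 := by
      have : Tendsto (fun s : ℝ => s * B) (𝓝[>] 0) (𝓝 (0 * B)) :=
        ((continuous_id.mul continuous_const).tendsto 0).mono_left nhdsWithin_le_nhds
      exact this.eventually_lt_const (by linarith)
    have hs2 : ∀ᶠ s : ℝ in 𝓝[>] 0, s * (7 * B ^ 2) < ε ^ 2 := by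
      have : Tendsto (fun s : ℝ => s * (7 * B ^ 2)) (𝓝[>] 0) (𝓝 (0 * (7 * B ^ 2))) :=
        ((continuous_id.mul continuous_const).tendsto 0).mono_left nhdsWithin_le_nhds
      exact this.eventually_lt_const (by nlinarith)
    filter_upwards [hs1, hs2, self_mem_nhdsWithin] with s hsB hsB2 hs x hx
    have hs : 0 < s := hs
    rw [hthick, not_lt] at hx ⊢
    set y := x + s • W x with hy
    have hyx : y - x = s • W x := by rw [hy]; abel
    have hyxn : ‖y - x‖ ≤ s * B := by
      rw [hyx, norm_smul, Real.norm_eq_abs, abs_of_pos hs]; gcongr; exact hB x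
    -- Far points cannot reach the tube in a displacement of size `sB`; for near ones the squared
    -- distance is compared directly.
    by_cases hfar : ε + (ε₀ - ε) / 4 ≤ infDist x Γ
    · have := hinf y x
      rw [norm_sub_rev] at this
      linarith
    push Not at hfar
    have hyd := hinf x y
    have h1 := hVlip x y (by linarith) (by linarith) (by linarith)
    -- The foot of `y` competes in the distance from `x`. Expanding the square and using `V y ≈ V x`
    -- gives `d(y)² ≥ d(x)² + 2⟨V x, y - x⟩ - 7‖y - x‖²`, where `7 = 2·3 + 1`; the inner product is
    -- of order `s` and dominates.
    have h2 : infDist x Γ ^ 2 ≤ ‖V y - (y - x)‖ ^ 2 := by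
      have e : V y - (y - x) = x - P y := by simp only [hV]; abel
      rw [e, ← dist_eq_norm]
      have := infDist_nonneg (x := x) (s := Γ)
      gcongr
      exact infDist_le_dist_of_mem (hP y).1
    rw [norm_sub_sq_real, hVn] at h2
    have h3 : -(3 * ‖y - x‖ ^ 2) ≤ inner ℝ (V y - V x) (y - x) := by
      have h4 := (abs_le.1 (abs_real_inner_le_norm (V y - V x) (y - x))).1
      nlinarith [norm_nonneg (y - x)]
    have h4 : s * (infDist x Γ ^ 2 / 2) ≤ inner ℝ (V x) (y - x) := by
      rw [hyx, real_inner_smul_right]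
      gcongr
      have e : inner ℝ (V x) (W x) = infDist x Γ ^ 2 + inner ℝ (V x) (W x - V x) := by
        rw [inner_sub_right, real_inner_self_eq_norm_sq, hVn]; ring
      have h5 := (abs_le.1 (abs_real_inner_le_norm (V x) (W x - V x))).1
      have h6 := hWV x (by linarith)
      rw [hVn] at h5
      rw [e]
      nlinarith
    rw [inner_sub_left] at h3
    have h5 : ‖y - x‖ ^ 2 ≤ (s * B) ^ 2 := by gcongr
    have h6 : ε ^ 2 ≤ infDist x Γ ^ 2 := by gcongr
    have h7 : ε ^ 2 ≤ infDist y Γ ^ 2 := by nlinarith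
    exact (sq_le_sq₀ hε.le infDist_nonneg).1 h7

/-! ### Zero extensions as test functions. -/

/-- `w` is continuous on the whole space, vanishes outside the bounded open set `U`, and has in `U`
the continuous gradient `D`, which is bounded by `M` and extended by zero outside `U`. -/
structure IsZeroExtension {E : Type*} [NormedAddCommGroup E] [InnerProductSpace ℝ E]
    [CompleteSpace E] (U : Set E) (w : E → ℝ) (D : E → E) (M : ℝ) : Prop where
  isOpen : IsOpen U
  isBounded : Bornology.IsBounded U
  continuous : Continuous w
  eq_zero : ∀ x ∉ U, w x = 0
  hasGradientAt : ∀ x ∈ U, HasGradientAt w (D x) x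
  continuousOn_grad : ContinuousOn D U
  grad_eq_zero : ∀ x ∉ U, D x = 0
  norm_grad_le : ∀ x, ‖D x‖ ≤ M

/-- Rescalings of one profile that vanishes on `[-1, 1]` and is the identity for large arguments;
scaling leaves the derivative bound unchanged. Composing with a zero extension gives a `C¹` function
supported inside the open set, whatever its boundary looks like. -/
theorem exists_truncation : ∃ (ψ : ℕ → ℝ → ℝ) (K : ℝ), (∀ k, ContDiff ℝ 1 (ψ k)) ∧
    (∀ k, ∃ δ > 0, ∀ t, |t| ≤ δ → ψ k t = 0) ∧ (∀ k t, |deriv (ψ k) t| ≤ K) ∧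
    (∀ k t, |ψ k t| ≤ |t|) ∧
    (∀ t, Filter.Tendsto (fun k => ψ k t) Filter.atTop (nhds t)) ∧
    (∀ t ≠ 0, Filter.Tendsto (fun k => deriv (ψ k) t) Filter.atTop (nhds 1)) := by
  set θ : ℝ → ℝ := fun t => t * Real.smoothTransition (t ^ 2 - 1) with hθ
  have hθs : ContDiff ℝ 1 θ := by
    have : ContDiff ℝ 1 Real.smoothTransition := Real.smoothTransition.contDiff
    exact contDiff_id.mul (this.comp (by fun_prop))
  have hθ0 : ∀ t, |t| ≤ 1 → θ t = 0 := fun t ht => by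
    have : t ^ 2 ≤ 1 := by rw [← sq_abs]; nlinarith [abs_nonneg t]
    simp [hθ, Real.smoothTransition.zero_of_nonpos (by linarith : t ^ 2 - 1 ≤ 0)]
  have hθ1 : ∀ t, 2 ≤ |t| → θ t = t := fun t ht => by
    have : 2 ≤ t ^ 2 := by rw [← sq_abs]; nlinarith [abs_nonneg t]
    simp [hθ, Real.smoothTransition.one_of_one_le (by linarith : 1 ≤ t ^ 2 - 1)]
  have hθle : ∀ t, |θ t| ≤ |t| := fun t => by
    rw [hθ]; simp only [abs_mul]
    rw [abs_of_nonneg (Real.smoothTransition.nonneg _)]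
    exact mul_le_of_le_one_right (abs_nonneg t) (Real.smoothTransition.le_one _)
  have hθd : ∀ t, 2 < |t| → deriv θ t = 1 := fun t ht => by
    have : θ =ᶠ[nhds t] id := by
      filter_upwards [continuous_abs.continuousAt.eventually_const_lt ht] with s hs
      exact hθ1 s hs.le
    rw [this.deriv_eq]; simp
  obtain ⟨K, hK⟩ := (isCompact_Icc (a := (-2 : ℝ)) (b := 2)).exists_bound_of_continuousOn
    (hθs.continuous_deriv le_rfl).continuousOn
  have hdb : ∀ t, |deriv θ t| ≤ max K 1 := fun t => by
    by_cases ht : |t| ≤ 2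
    · exact (hK t (abs_le.1 ht)).trans (le_max_left _ _)
    · rw [hθd t (not_le.1 ht), abs_one]; exact le_max_right _ _
  have hpos : ∀ k : ℕ, (0 : ℝ) < k + 1 := fun k => by positivity
  have hder : ∀ (k : ℕ) (t : ℝ),
      deriv (fun t => ((k : ℝ) + 1)⁻¹ * θ ((k + 1) * t)) t = deriv θ ((k + 1) * t) := fun k t => by
    have h1 : HasDerivAt θ (deriv θ ((k + 1) * t)) ((k + 1) * t) :=
      (hθs.differentiable (by simp) _).hasDerivAt
    have h2 : HasDerivAt (fun t : ℝ => ((k : ℝ) + 1) * t) ((k + 1) * 1) t :=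
      (hasDerivAt_id t).const_mul _
    refine ((h1.comp t h2).const_mul ((k : ℝ) + 1)⁻¹).deriv.trans ?_
    field_simp [(hpos k).ne']
  have hlarge : ∀ t ≠ (0 : ℝ), ∀ᶠ k : ℕ in Filter.atTop, 2 < |((k : ℝ) + 1) * t| := fun t ht => by
    have h1 : Filter.Tendsto (fun k : ℕ => ((k : ℝ) + 1) * |t|) Filter.atTop Filter.atTop :=
      (tendsto_natCast_atTop_atTop.atTop_add tendsto_const_nhds).atTop_mul_const
        (abs_pos.2 ht)
    filter_upwards [h1.eventually_gt_atTop 2] with k hk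
    rwa [abs_mul, abs_of_pos (hpos k)]
  refine ⟨fun k t => ((k : ℝ) + 1)⁻¹ * θ ((k + 1) * t), max K 1, fun k => ?_, fun k => ?_,
    fun k t => ?_, fun k t => ?_, fun t => ?_, fun t ht => ?_⟩
  · exact contDiff_const.mul (hθs.comp (by fun_prop))
  · refine ⟨((k : ℝ) + 1)⁻¹, inv_pos.2 (hpos k), fun t ht => ?_⟩
    change ((k : ℝ) + 1)⁻¹ * θ ((k + 1) * t) = 0
    rw [hθ0, mul_zero]
    rw [abs_mul, abs_of_pos (hpos k)]
    calc _ ≤ ((k : ℝ) + 1) * ((k : ℝ) + 1)⁻¹ := by gcongr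
      _ = 1 := mul_inv_cancel₀ (hpos k).ne'
  · rw [hder]; exact hdb _
  · rw [abs_mul, abs_of_pos (inv_pos.2 (hpos k)), inv_mul_le_iff₀ (hpos k)]
    refine (hθle _).trans_eq ?_
    rw [abs_mul, abs_of_pos (hpos k)]
  · rcases eq_or_ne t 0 with rfl | ht
    · simp [hθ]
    · refine tendsto_const_nhds.congr' ?_
      filter_upwards [hlarge t ht] with k hk
      rw [hθ1 _ hk.le, inv_mul_cancel_left₀ (hpos k).ne']
  · refine tendsto_const_nhds.congr' ?_
    filter_upwards [hlarge t ht] with k hk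
    rw [hder, hθd _ hk]

section

variable {E : Type*} [NormedAddCommGroup E] [InnerProductSpace ℝ E] [FiniteDimensional ℝ E]

namespace IsZeroExtension

variable {U : Set E} {w : E → ℝ} {D : E → E} {M : ℝ}

theorem hasCompactSupport (h : IsZeroExtension U w D M) : HasCompactSupport w :=
  HasCompactSupport.of_support_subset_isCompact h.isBounded.isCompact_closure fun x hx =>
    subset_closure (by_contra fun hxU => hx (h.eq_zero x hxU))

theorem contDiffOn (h : IsZeroExtension U w D M) : ContDiffOn ℝ 1 w U := by
  rw [show (1 : WithTop ℕ∞) = 0 + 1 by simp, contDiffOn_succ_iff_fderiv_of_isOpen h.isOpen]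
  refine ⟨fun x hx => (h.hasGradientAt x hx).hasFDerivAt.differentiableAt.differentiableWithinAt, by simp,
    contDiffOn_zero.2 ?_⟩
  refine ((InnerProductSpace.toDual ℝ E).continuous.comp_continuousOn h.continuousOn_grad).congr ?_
  intro x hx
  exact (h.hasGradientAt x hx).hasFDerivAt.fderiv

variable {ψ : ℝ → ℝ} {δ : ℝ}

theorem tsupport_comp_subset (h : IsZeroExtension U w D M) (hδ : 0 < δ)
    (hψ : ∀ t, |t| ≤ δ → ψ t = 0) : tsupport (fun x => ψ (w x)) ⊆ U := by
  have h1 : tsupport (fun x => ψ (w x)) ⊆ {x | δ ≤ |w x|} := by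
    refine closure_minimal (fun x hx => ?_) (isClosed_le continuous_const h.continuous.abs)
    by_contra hx'
    exact hx (hψ _ (not_le.1 hx').le)
  intro x hx
  by_contra hxU
  have : δ ≤ |w x| := h1 hx
  rw [h.eq_zero x hxU, abs_zero] at this
  linarith

theorem contDiff_comp (h : IsZeroExtension U w D M) (hψs : ContDiff ℝ 1 ψ) (hδ : 0 < δ)
    (hψ : ∀ t, |t| ≤ δ → ψ t = 0) : ContDiff ℝ 1 (fun x => ψ (w x)) := by
  refine contDiff_iff_contDiffAt.2 fun x => ?_
  by_cases hx : x ∈ U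
  · exact hψs.contDiffAt.comp x (h.contDiffOn.contDiffAt (h.isOpen.mem_nhds hx))
  · have hx' : x ∉ tsupport (fun x => ψ (w x)) := fun hx' =>
      hx (h.tsupport_comp_subset hδ hψ hx')
    exact contDiffAt_const.congr_of_eventuallyEq (notMem_tsupport_iff_eventuallyEq.1 hx')

theorem fderiv_comp_apply (h : IsZeroExtension U w D M) (hψs : ContDiff ℝ 1 ψ) (hδ : 0 < δ)
    (hψ : ∀ t, |t| ≤ δ → ψ t = 0) (x ξ : E) :
    fderiv ℝ (fun x => ψ (w x)) x ξ = deriv ψ (w x) * inner ℝ (D x) ξ := by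
  by_cases hx : x ∈ U
  · have h1 := (hψs.differentiable (by simp) (w x)).hasDerivAt
    have h2 := h1.comp_hasFDerivAt x (h.hasGradientAt x hx).hasFDerivAt
    rw [show (fun x => ψ (w x)) = ψ ∘ w from rfl, h2.fderiv]
    simp
  · have hx' : x ∉ tsupport (fun x => ψ (w x)) := fun hx' =>
      hx (h.tsupport_comp_subset hδ hψ hx')
    rw [(notMem_tsupport_iff_eventuallyEq.1 hx').fderiv_eq, h.grad_eq_zero x hx]
    simp

/-- The segment between two points may leave `U`, so the mean value inequality is applied to the
globally `C¹` truncations, and the bound passes to the limit. -/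
theorem exists_lipschitz_bound :
    ∃ K : ℝ, ∀ {U : Set E} {w : E → ℝ} {D : E → E} {M : ℝ}, IsZeroExtension U w D M →
      ∀ x y, |w x - w y| ≤ K * M * ‖x - y‖ := by
  obtain ⟨ψ, K, hs, h0, hd, -, hlim, -⟩ := exists_truncation
  refine ⟨K, fun {U w D M} h x y => ?_⟩
  refine le_of_tendsto (((hlim (w x)).sub (hlim (w y))).abs) (Filter.Eventually.of_forall fun k => ?_)
  obtain ⟨δ, hδ, hψ⟩ := h0 k
  have hK : 0 ≤ K := (abs_nonneg _).trans (hd 0 0)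
  have hM : 0 ≤ M := (norm_nonneg _).trans (h.norm_grad_le 0)
  refine Convex.norm_image_sub_le_of_norm_fderiv_le (𝕜 := ℝ) (f := fun x => ψ k (w x)) (s := univ)
    (fun z _ => (h.contDiff_comp (hs k) hδ hψ).differentiable (by simp) z) (fun z _ => ?_)
    convex_univ (mem_univ y) (mem_univ x)
  refine ContinuousLinearMap.opNorm_le_bound _ (by positivity) fun ξ => ?_
  rw [h.fderiv_comp_apply (hs k) hδ hψ, norm_mul, mul_assoc]
  refine mul_le_mul (hd k _) ?_ (norm_nonneg _) hK
  exact (norm_inner_le_norm _ _).trans (by gcongr; exact h.norm_grad_le z)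

end IsZeroExtension

variable [MeasurableSpace E] [BorelSpace E]

theorem integrable_of_bounded_of_eq_zero {F : Type*} [NormedAddCommGroup F] {g : E → F} {C : ℝ}
    {S : Set E} (hg : AEStronglyMeasurable g volume) (hC : ∀ x, ‖g x‖ ≤ C)
    (hS : Bornology.IsBounded S) (h0 : ∀ x ∉ S, g x = 0) : Integrable g volume := by
  obtain ⟨R, hR⟩ := hS.subset_closedBall 0
  have h1 : IntegrableOn g (Metric.closedBall 0 R) volume :=
    IntegrableOn.of_bound measure_closedBall_lt_top hg.restrict C (ae_of_all _ hC)
  exact (integrableOn_iff_integrable_of_support_subset fun x hx => by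
    by_contra hxR
    exact hx (h0 x fun hxS => hxR (hR hxS))).1 h1

namespace IsZeroExtension

variable {U : Set E} {w : E → ℝ} {D : E → E} {M : ℝ}

theorem measurable_grad (h : IsZeroExtension U w D M) : Measurable D := by
  classical
  have : D = U.piecewise D (fun _ => 0) := by
    ext1 x
    by_cases hx : x ∈ U
    · simp [hx]
    · simp [hx, h.grad_eq_zero x hx]
  rw [this]
  exact h.continuousOn_grad.measurable_piecewise continuousOn_const h.isOpen.measurableSet

theorem integrable_grad (h : IsZeroExtension U w D M) : Integrable D volume :=
  integrable_of_bounded_of_eq_zero h.measurable_grad.aestronglyMeasurable h.norm_grad_le h.isBounded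
    h.grad_eq_zero

/-- The gradient vanishes almost everywhere on the zero set. -/
theorem ae_grad_eq_zero (h : IsZeroExtension U w D M) : ∀ᵐ x, w x = 0 → D x = 0 := by
  rcases subsingleton_or_nontrivial E with hE | hE
  · exact ae_of_all _ fun x _ => Subsingleton.elim _ _
  obtain ⟨e, he⟩ := exists_ne (0 : E)
  set S : Set E := U ∩ {x | w x = 0}
  have hS : MeasurableSet S := h.isOpen.measurableSet.inter
    (isClosed_singleton.preimage h.continuous).measurableSet
  -- On the zero set `w` is approximated with constant `0` by the zero map, so its derivative
  -- vanishes at almost every point there. The factor `e` only serves to produce a map from `E` to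
  -- itself.
  have happ : ApproximatesLinearOn (fun x => w x • e) (0 : E →L[ℝ] E) S 0 := by
    intro x hx y hy
    have hx : w x = 0 := hx.2
    have hy : w y = 0 := hy.2
    simp [hx, hy]
  have := happ.norm_fderiv_sub_le volume hS
    (fun x => ((InnerProductSpace.toDual ℝ E) (D x)).smulRight e)
    (fun x hx => ((h.hasGradientAt x hx.1).hasFDerivAt.smul_const e).hasFDerivWithinAt)
  rw [ae_restrict_iff' hS] at this
  filter_upwards [this] with x hx hwx
  by_cases hxU : x ∈ U
  · have h1 := hx ⟨hxU, hwx⟩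
    rw [sub_zero, nonpos_iff_eq_zero, nnnorm_eq_zero] at h1
    have h2 := DFunLike.congr_fun h1 (D x)
    simpa [he] using h2
  · exact h.grad_eq_zero x hxU

end IsZeroExtension

open Metric in
-- Mollifying `φ` approximates it and its derivative uniformly, with support still in `Ω`, while `G`
-- and `h` are integrable.
theorem weak_equation_of_contDiff_one {Ω : Set E} (hΩ : IsOpen Ω) {G : E → E} {h : E → ℝ}
    (hG : Integrable G volume) (hh : Integrable h volume)
    (hweak : ∀ φ : E → ℝ, ContDiff ℝ ∞ φ → HasCompactSupport φ → tsupport φ ⊆ Ω →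
      ∫ x, fderiv ℝ φ x (G x) = ∫ x, h x * φ x)
    {φ : E → ℝ} (hφ : ContDiff ℝ 1 φ) (hφc : HasCompactSupport φ) (hφΩ : tsupport φ ⊆ Ω) :
    ∫ x, fderiv ℝ φ x (G x) = ∫ x, h x * φ x := by
  have hdc : Continuous (fderiv ℝ φ) := hφ.continuous_fderiv (by simp)
  have hint1 : ∀ χ : E → ℝ, ContDiff ℝ 1 χ → HasCompactSupport χ →
      Integrable (fun x => fderiv ℝ χ x (G x)) volume := by
    intro χ hχ hχc
    obtain ⟨C, hC⟩ := (hχc.fderiv ℝ).exists_bound_of_continuous (hχ.continuous_fderiv (by simp))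
    refine (hG.norm.const_mul C).mono' ?_ (ae_of_all _ fun x => ?_)
    · exact (isBoundedBilinearMap_apply.continuous (𝕜 := ℝ)).comp_aestronglyMeasurable₂
        (hχ.continuous_fderiv (by simp)).aestronglyMeasurable hG.aestronglyMeasurable
    · exact (ContinuousLinearMap.le_opNorm _ _).trans (by gcongr; exact hC x)
  have hint2 : ∀ χ : E → ℝ, ContDiff ℝ 1 χ → HasCompactSupport χ →
      Integrable (fun x => h x * χ x) volume := by
    intro χ hχ hχc
    obtain ⟨C, hC⟩ := hχc.exists_bound_of_continuous hχ.continuous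
    exact hh.mul_bdd hχ.continuous.aestronglyMeasurable (ae_of_all _ hC)
  set N := (∫ x, ‖G x‖) + ∫ x, ‖h x‖ with hN
  have hN0 : 0 ≤ N := add_nonneg (integral_nonneg fun _ => norm_nonneg _)
    (integral_nonneg fun _ => norm_nonneg _)
  have key : ∀ δ > 0, |∫ x, fderiv ℝ φ x (G x) - h x * φ x| ≤ δ * N := by
    intro δ hδ
    obtain ⟨r₁, hr₁, h1⟩ := Metric.uniformContinuous_iff.1
      (hφc.uniformContinuous_of_continuous hφ.continuous) δ hδ
    obtain ⟨r₂, hr₂, h2⟩ := Metric.uniformContinuous_iff.1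
      ((hφc.fderiv ℝ).uniformContinuous_of_continuous hdc) δ hδ
    obtain ⟨r₃, hr₃, h3⟩ := hφc.exists_cthickening_subset_open hΩ hφΩ
    set r := min r₁ (min r₂ r₃) with hr
    have hrpos : 0 < r := by positivity
    let ρ : ContDiffBump (0 : E) := ⟨r / 2, r, by linarith, by linarith⟩
    have hρr : ρ.rOut = r := rfl
    set χ : E → ℝ := convolution (ρ.normed volume) φ (ContinuousLinearMap.lsmul ℝ ℝ) volume with hχ
    have hχs : ContDiff ℝ ∞ χ := ρ.hasCompactSupport_normed.contDiff_convolution_left _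
      ρ.contDiff_normed hφ.continuous.locallyIntegrable
    have hχs1 : ContDiff ℝ 1 χ := hχs.of_le (by norm_cast)
    have hχc : HasCompactSupport χ := ρ.hasCompactSupport_normed.convolution _ hφc
    have hχΩ : tsupport χ ⊆ Ω := by
      refine Subset.trans (closure_minimal ?_ isClosed_cthickening) h3
      refine (support_convolution_subset (ContinuousLinearMap.lsmul ℝ ℝ)).trans ?_
      rintro _ ⟨z, hz, y, hy, rfl⟩
      rw [ρ.support_normed_eq, hρr, mem_ball_zero_iff] at hz
      refine mem_cthickening_of_dist_le _ y _ _ (subset_tsupport _ hy) ?_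
      rw [dist_eq_norm]
      simp only [add_sub_cancel_right]
      exact hz.le.trans ((min_le_right _ _).trans (min_le_right _ _))
    have hd : ∀ x, fderiv ℝ χ x = convolution (ρ.normed volume) (fderiv ℝ φ)
        (ContinuousLinearMap.lsmul ℝ ℝ) volume x := fun x => by
      rw [(hφc.hasFDerivAt_convolution_right (ContinuousLinearMap.lsmul ℝ ℝ)
        ρ.integrable_normed.locallyIntegrable hφ x).fderiv]
      rfl
    have e1 : ∀ x, |φ x - χ x| ≤ δ := fun x => by
      rw [← Real.dist_eq, dist_comm]
      refine ρ.dist_normed_convolution_le hφ.continuous.aestronglyMeasurable fun y hy => ?_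
      exact (h1 ((mem_ball.1 hy).trans_le (min_le_left _ _))).le
    have e2 : ∀ x, ‖fderiv ℝ φ x - fderiv ℝ χ x‖ ≤ δ := fun x => by
      rw [← dist_eq_norm, dist_comm, hd]
      refine ρ.dist_normed_convolution_le hdc.aestronglyMeasurable fun y hy => ?_
      exact (h2 ((mem_ball.1 hy).trans_le ((min_le_right _ _).trans (min_le_left _ _)))).le
    have e3 : ∫ x, fderiv ℝ χ x (G x) - h x * χ x = 0 := by
      rw [integral_sub (hint1 χ hχs1 hχc) (hint2 χ hχs1 hχc), hweak χ hχs hχc hχΩ, sub_self]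
    have e4 : ∫ x, fderiv ℝ φ x (G x) - h x * φ x =
        ∫ x, (fderiv ℝ φ x (G x) - h x * φ x) - (fderiv ℝ χ x (G x) - h x * χ x) := by
      have := integral_sub ((hint1 φ hφ hφc).sub (hint2 φ hφ hφc))
        ((hint1 χ hχs1 hχc).sub (hint2 χ hχs1 hχc))
      simp only [Pi.sub_apply] at this
      rw [this, e3, sub_zero]
    rw [e4, ← Real.norm_eq_abs, hN, ← integral_add hG.norm hh.norm, ← integral_const_mul]
    refine norm_integral_le_of_norm_le ((hG.norm.add hh.norm).const_mul δ) (ae_of_all _ fun x => ?_)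
    have e5 : (fderiv ℝ φ x (G x) - h x * φ x) - (fderiv ℝ χ x (G x) - h x * χ x)
        = (fderiv ℝ φ x - fderiv ℝ χ x) (G x) - h x * (φ x - χ x) := by
      rw [sub_apply]; ring
    rw [e5, mul_add]
    refine (norm_sub_le _ _).trans (add_le_add ?_ ?_)
    · exact (ContinuousLinearMap.le_opNorm _ _).trans (by gcongr; exact e2 x)
    · rw [norm_mul, mul_comm]; gcongr; exact e1 x
  have hz : ∫ x, fderiv ℝ φ x (G x) - h x * φ x = 0 := by
    rw [← abs_nonpos_iff]
    refine le_of_forall_pos_le_add fun δ hδ => ?_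
    refine (key (δ / (N + 1)) (by positivity)).trans ?_
    rw [zero_add, div_mul_eq_mul_div, div_le_iff₀ (by positivity)]
    nlinarith
  rw [integral_sub (hint1 φ hφ hφc) (hint2 φ hφ hφc)] at hz
  linarith

/-- A weak equation may be tested against functions that are continuous on the whole space and
`C¹` with bounded gradient in an open subset, outside of which they vanish. -/
theorem IsZeroExtension.weak_equation {Ω U : Set E} (hΩ : IsOpen Ω) {G : E → E} {h : E → ℝ}
    (hG : Integrable G volume) (hh : Continuous h) (hhc : HasCompactSupport h)
    (hweak : ∀ φ : E → ℝ, ContDiff ℝ ∞ φ → HasCompactSupport φ → tsupport φ ⊆ Ω →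
      ∫ x, fderiv ℝ φ x (G x) = ∫ x, h x * φ x)
    {w : E → ℝ} {D : E → E} {M : ℝ} (hw : IsZeroExtension U w D M) (hU : U ⊆ Ω) :
    ∫ x, inner ℝ (D x) (G x) = ∫ x, h x * w x := by
  obtain ⟨ψ, K, hs, h0, hd, hle, hlim, hdlim⟩ := exists_truncation
  have heq : ∀ k, ∫ x, deriv (ψ k) (w x) * inner ℝ (D x) (G x) = ∫ x, h x * ψ k (w x) := by
    intro k
    obtain ⟨δ, hδ, hψ⟩ := h0 k
    have hsub := hw.tsupport_comp_subset hδ hψ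
    have := weak_equation_of_contDiff_one hΩ hG (hh.integrable_of_hasCompactSupport hhc) hweak
      (hw.contDiff_comp (hs k) hδ hψ)
      (HasCompactSupport.of_support_subset_isCompact hw.isBounded.isCompact_closure
        ((subset_tsupport _).trans (hsub.trans subset_closure))) (hsub.trans hU)
    simpa only [hw.fderiv_comp_apply (hs k) hδ hψ] using this
  have hDG : AEStronglyMeasurable (fun x => inner ℝ (D x) (G x)) volume :=
    hw.measurable_grad.aestronglyMeasurable.inner hG.aestronglyMeasurable
  have hK : 0 ≤ K := (abs_nonneg _).trans (hd 0 0)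
  have hl : Filter.Tendsto (fun k => ∫ x, deriv (ψ k) (w x) * inner ℝ (D x) (G x)) Filter.atTop
      (nhds (∫ x, inner ℝ (D x) (G x))) := by
    refine tendsto_integral_filter_of_dominated_convergence (fun x => K * (M * ‖G x‖))
      (Filter.Eventually.of_forall fun k => ?_) (Filter.Eventually.of_forall fun k =>
        ae_of_all _ fun x => ?_) ((hG.norm.const_mul M).const_mul K) ?_
    · exact (((hs k).continuous_deriv le_rfl).comp hw.continuous).aestronglyMeasurable.mul hDG
    · rw [norm_mul]
      refine mul_le_mul (hd k _) ?_ (norm_nonneg _) hK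
      exact (norm_inner_le_norm _ _).trans (by gcongr; exact hw.norm_grad_le x)
    -- The derivatives of the truncations converge to `1` only off the zero set of `w`; on it the
    -- gradient is zero almost everywhere.
    · filter_upwards [hw.ae_grad_eq_zero] with x hx
      by_cases hwx : w x = 0
      · simp [hx hwx]
      · simpa using (hdlim _ hwx).mul_const (inner ℝ (D x) (G x))
  have hr : Filter.Tendsto (fun k => ∫ x, h x * ψ k (w x)) Filter.atTop
      (nhds (∫ x, h x * w x)) := by
    have hi : Integrable (fun x => h x * w x) volume :=
      (hh.mul hw.continuous).integrable_of_hasCompactSupport hhc.mul_right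
    refine tendsto_integral_filter_of_dominated_convergence (fun x => ‖h x * w x‖)
      (Filter.Eventually.of_forall fun k => ?_) (Filter.Eventually.of_forall fun k =>
        ae_of_all _ fun x => ?_) hi.norm (ae_of_all _ fun x => (hlim _).const_mul _)
    · exact (hh.mul ((hs k).continuous.comp hw.continuous)).aestronglyMeasurable
    · rw [norm_mul, norm_mul]
      gcongr
      exact hle k _
  simp_rw [heq] at hl
  exact tendsto_nhds_unique hl hr

end

/-! ### Jacobians of small perturbations of the identity. -/

section
open Filter Topology

variable {E : Type*} [NormedAddCommGroup E] [InnerProductSpace ℝ E] [FiniteDimensional ℝ E]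

theorem ContinuousLinearMap.contDiff_det : ContDiff ℝ 1 fun A : E →L[ℝ] E => A.det := by
  set b := stdOrthonormalBasis ℝ E
  have e : (fun A : E →L[ℝ] E => A.det) = fun A : E →L[ℝ] E =>
      ∑ σ : Equiv.Perm (Fin (Module.finrank ℝ E)), ((Equiv.Perm.sign σ : ℤ) : ℝ) *
        ∏ i, inner ℝ (b (σ i)) (A (b i)) := by
    ext A
    rw [ContinuousLinearMap.det, ← LinearMap.det_toMatrix b.toBasis, Matrix.det_apply']
    simp [LinearMap.toMatrix_apply, b.repr_apply_apply]
  rw [e]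
  refine ContDiff.sum fun σ _ => contDiff_const.mul (contDiff_prod fun i _ => ?_)
  exact contDiff_const.inner ℝ (contDiff_id.clm_apply contDiff_const)

/-- Uniformity in `A` makes the Jacobians of `id + sW` positive everywhere for small `s` and
dominates their difference quotients. -/
theorem exists_abs_det_one_add_smul_sub_one_le (K : ℝ) :
    ∃ C : ℝ, 0 ≤ C ∧ ∀ A : E →L[ℝ] E, ‖A‖ ≤ K → ∀ s : ℝ, 0 ≤ s → s ≤ 1 →
      |(1 + s • A).det - 1| ≤ C * s := by
  obtain ⟨L, hL⟩ := (ContinuousLinearMap.contDiff_det (E := E)).contDiffOn.exists_lipschitzOnWith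
    one_ne_zero (convex_closedBall (1 : E →L[ℝ] E) K) (isCompact_closedBall _ _)
  refine ⟨L * max K 0, by positivity, fun A hA s hs hs1 => ?_⟩
  have hK : 0 ≤ K := (norm_nonneg A).trans hA
  have h1 : ‖s • A‖ ≤ s * K := by
    rw [norm_smul, Real.norm_eq_abs, abs_of_nonneg hs]; gcongr
  have h2 := hL.norm_sub_le (x := 1 + s • A) (y := 1)
    (by rw [Metric.mem_closedBall, dist_eq_norm, add_sub_cancel_left]; nlinarith)
    (Metric.mem_closedBall_self hK)
  rw [add_sub_cancel_left] at h2
  have h3 : (1 : E →L[ℝ] E).det = 1 := by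
    rw [ContinuousLinearMap.det]; exact LinearMap.det_id
  rw [h3, Real.norm_eq_abs] at h2
  refine h2.trans ?_
  calc _ ≤ (L : ℝ) * (s * K) := by gcongr
    _ ≤ (L : ℝ) * (s * max K 0) := by gcongr; exact le_max_left _ _
    _ = _ := by ring

theorem tendsto_det_one_add_smul_slope (A : E →L[ℝ] E) :
    Tendsto (fun s : ℝ => s⁻¹ * ((1 + s • A).det - 1)) (𝓝[>] 0)
      (𝓝 (LinearMap.trace ℝ E A.toLinearMap)) := by
  set b := (stdOrthonormalBasis ℝ E).toBasis
  set Mx := LinearMap.toMatrix b b A.toLinearMap with hM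
  have hdet : ∀ s : ℝ, (1 + s • A).det = (1 + s • Mx).det := by
    intro s
    rw [ContinuousLinearMap.det, ← LinearMap.det_toMatrix b]
    congr 1
    have : ((1 + s • A : E →L[ℝ] E)).toLinearMap = LinearMap.id + s • A.toLinearMap := by
      ext; simp
    rw [this, map_add, map_smul, LinearMap.toMatrix_id]
  rw [LinearMap.trace_eq_matrix_trace ℝ b]
  -- The remainder in `det (1 + sM) = 1 + s tr M + s² q(s)`.
  set q := (1 + (Polynomial.X : Polynomial ℝ) • Mx.map Polynomial.C).det.divX.divX
  have h1 : Tendsto (fun s : ℝ => Mx.trace + q.eval s * s) (𝓝[>] 0)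
      (𝓝 (Mx.trace + q.eval 0 * 0)) :=
    ((continuous_const.add (q.continuous.mul continuous_id)).tendsto 0).mono_left
      nhdsWithin_le_nhds
  rw [mul_zero, add_zero] at h1
  refine h1.congr' ?_
  filter_upwards [self_mem_nhdsWithin] with s hs
  have hs : s ≠ 0 := ne_of_gt hs
  rw [hdet, Matrix.det_one_add_smul]
  field_simp
  ring

/-- Small perturbations of the identity are bijective. -/
theorem bijective_add_smul_of_lipschitz {W : E → E} {K : NNReal} (hW : LipschitzWith K W) {s : ℝ}
    (hs : 0 ≤ s) (hsK : s * K < 1) : Function.Bijective fun x => x + s • W x := by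
  have hlip : ∀ x y, ‖s • W x - s • W y‖ ≤ s * K * ‖x - y‖ := fun x y => by
    rw [← smul_sub, norm_smul, Real.norm_eq_abs, abs_of_nonneg hs, mul_assoc]
    gcongr
    exact hW.norm_sub_le x y
  constructor
  · intro x y hxy
    have hxy : x + s • W x = y + s • W y := hxy
    have h1 : x - y = -(s • W x - s • W y) := by
      rw [eq_neg_iff_add_eq_zero, sub_add_sub_comm, sub_eq_zero]; exact hxy
    have h2 := hlip x y
    rw [← norm_neg, ← h1] at h2
    by_contra hne
    have : 0 < ‖x - y‖ := norm_pos_iff.2 (sub_ne_zero.2 hne)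
    nlinarith
  · have happ : ApproximatesLinearOn (fun x => x + s • W x)
        ((ContinuousLinearEquiv.refl ℝ E : E ≃L[ℝ] E) : E →L[ℝ] E) univ
        ⟨s * K, by positivity⟩ := by
      intro x _ y _
      have e : x + s • W x - (y + s • W y) - (ContinuousLinearEquiv.refl ℝ E : E →L[ℝ] E) (x - y)
        = s • W x - s • W y := by simp; abel
      rw [e]
      exact hlip x y
    refine happ.surjective ?_
    rcases subsingleton_or_nontrivial E with hE | hE
    · exact Or.inl hE
    · right
      have : ‖((ContinuousLinearEquiv.refl ℝ E).symm : E →L[ℝ] E)‖₊ = 1 := by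
        ext; exact ContinuousLinearMap.norm_id
      rw [this, inv_one]
      exact hsK

variable [MeasurableSpace E] [BorelSpace E]

theorem integral_comp_mul_abs_det {Φ : E → E} {Φ' : E → E →L[ℝ] E}
    (hΦ : ∀ x, HasFDerivAt Φ (Φ' x) x) (hbij : Function.Bijective Φ) (H : E → ℝ) :
    ∫ x, H (Φ x) * |(Φ' x).det| = ∫ x, H x := by
  have := integral_image_eq_integral_abs_det_fderiv_smul volume MeasurableSet.univ
    (fun x _ => (hΦ x).hasFDerivWithinAt) hbij.injective.injOn H
  rw [image_univ, hbij.surjective.range_eq, setIntegral_univ, setIntegral_univ] at this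
  rw [this]
  simp_rw [smul_eq_mul, mul_comm]

end

/-! ### Domain variation and Pohozaev's inequality. -/

section
open Filter Topology

variable {E : Type*} [NormedAddCommGroup E] [InnerProductSpace ℝ E] [FiniteDimensional ℝ E]

theorem IsZeroExtension.comp {Ω : Set E} {v : E → ℝ} {G : E → E} {M : ℝ}
    (hv : IsZeroExtension Ω v G M) {Φ : E → E} {Φ' : E → E →L[ℝ] E} {L : ℝ}
    (hΦ : ∀ x, HasFDerivAt Φ (Φ' x) x) (hΦ' : Continuous Φ') (hL : ∀ x, ‖Φ' x‖ ≤ L)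
    (hout : ∀ x ∉ Ω, Φ x ∉ Ω) :
    IsZeroExtension (Φ ⁻¹' Ω) (fun x => v (Φ x))
      (fun x => ContinuousLinearMap.adjoint (Φ' x) (G (Φ x))) (L * M) where
  isOpen := hv.isOpen.preimage (continuous_iff_continuousAt.2 fun x => (hΦ x).continuousAt)
  isBounded := hv.isBounded.subset fun x hx => by_contra fun h => hout x h hx
  continuous := hv.continuous.comp (continuous_iff_continuousAt.2 fun x => (hΦ x).continuousAt)
  eq_zero x hx := hv.eq_zero _ hx
  hasGradientAt x hx := by
    rw [hasGradientAt_iff_hasFDerivAt]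
    refine ((hv.hasGradientAt _ hx).hasFDerivAt.comp x (hΦ x)).congr_fderiv ?_
    ext ξ
    simp [ContinuousLinearMap.adjoint_inner_left]
  continuousOn_grad := by
    have hΦc : Continuous Φ := continuous_iff_continuousAt.2 fun x => (hΦ x).continuousAt
    exact ((ContinuousLinearMap.adjoint.continuous.comp hΦ').continuousOn).clm_apply
      (hv.continuousOn_grad.comp hΦc.continuousOn fun x hx => hx)
  grad_eq_zero x hx := by rw [hv.grad_eq_zero _ hx, map_zero]
  norm_grad_le x := by
    refine (ContinuousLinearMap.le_opNorm _ _).trans ?_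
    rw [LinearIsometryEquiv.norm_map]
    have : 0 ≤ L := (norm_nonneg _).trans (hL x)
    gcongr
    · exact hL x
    · exact hv.norm_grad_le _

variable [MeasurableSpace E] [BorelSpace E]

theorem Continuous.integrable_of_eq_zero {g : E → ℝ} {S : Set E} (hg : Continuous g)
    (hS : Bornology.IsBounded S) (h0 : ∀ x ∉ S, g x = 0) : Integrable g volume :=
  hg.integrable_of_hasCompactSupport <| HasCompactSupport.of_support_subset_isCompact
    hS.isCompact_closure fun x hx => subset_closure (by_contra fun hxS => hx (h0 x hxS))

/-- Energy comparison of a weak solution with its composition with an outward map. -/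
theorem integral_energy_comp_nonneg {Ω : Set E} {v : E → ℝ} {G : E → E} {M : ℝ}
    (hv : IsZeroExtension Ω v G M) {h : E → ℝ} (hh : Continuous h) (hh0 : ∀ x ∉ Ω, h x = 0)
    (hweak : ∀ φ : E → ℝ, ContDiff ℝ ∞ φ → HasCompactSupport φ → tsupport φ ⊆ Ω →
      ∫ x, fderiv ℝ φ x (G x) = ∫ x, h x * φ x)
    {F : ℝ → ℝ} (hF : Continuous F) (hF0 : F 0 = 0)
    {Φ : E → E} {Φ' : E → E →L[ℝ] E} {L C : ℝ}
    (hΦ : ∀ x, HasFDerivAt Φ (Φ' x) x) (hΦ' : Continuous Φ') (hL : ∀ x, ‖Φ' x‖ ≤ L)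
    (hC : ∀ x, (Φ' x).det ≤ C) (hdet : ∀ x, 0 ≤ (Φ' x).det) (hbij : Function.Bijective Φ)
    (hout : ∀ x ∉ Ω, Φ x ∉ Ω) :
    0 ≤ ∫ x, ((‖ContinuousLinearMap.adjoint (Φ' x) (G (Φ x))‖ ^ 2
        - ‖G (Φ x)‖ ^ 2 * (Φ' x).det) / 2 - h x * (v (Φ x) - v x)
        + (F (v (Φ x)) * (Φ' x).det - F (v x))) := by
  have hΦc : Continuous Φ := continuous_iff_continuousAt.2 fun x => (hΦ x).continuousAt
  have hJc : Continuous fun x => (Φ' x).det := ContinuousLinearMap.contDiff_det.continuous.comp hΦ'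
  have hsub : Φ ⁻¹' Ω ⊆ Ω := fun x hx => by_contra fun h => hout x h hx
  have hw := hv.comp hΦ hΦ' hL hout
  set D : E → E := fun x => ContinuousLinearMap.adjoint (Φ' x) (G (Φ x)) with hD
  have hhc : HasCompactSupport h := HasCompactSupport.of_support_subset_isCompact
    hv.isBounded.isCompact_closure fun x hx => subset_closure (by_contra fun hxS => hx (hh0 x hxS))
  have hGm := hv.measurable_grad
  have hDm : Measurable D := hw.measurable_grad
  have hM : 0 ≤ M := (norm_nonneg _).trans (hv.norm_grad_le 0)
  have hD0 : ∀ x ∉ Ω, D x = 0 := fun x hx => hw.grad_eq_zero x fun h => hx (hsub h)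
  have e1 : ∫ x, inner ℝ (D x) (G x) = ∫ x, h x * v (Φ x) :=
    hw.weak_equation hv.isOpen hv.integrable_grad hh hhc hweak hsub
  have e2 : ∫ x, inner ℝ (G x) (G x) = ∫ x, h x * v x :=
    hv.weak_equation hv.isOpen hv.integrable_grad hh hhc hweak Subset.rfl
  have e3 : ∫ x, ‖G (Φ x)‖ ^ 2 * (Φ' x).det = ∫ x, ‖G x‖ ^ 2 := by
    have := integral_comp_mul_abs_det hΦ hbij (fun x => ‖G x‖ ^ 2)
    simpa only [abs_of_nonneg (hdet _)] using this
  have e4 : ∫ x, F (v (Φ x)) * (Φ' x).det = ∫ x, F (v x) := by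
    have := integral_comp_mul_abs_det hΦ hbij (fun x => F (v x))
    simpa only [abs_of_nonneg (hdet _)] using this
  have i1 : Integrable (fun x => inner ℝ (D x) (G x)) volume :=
    integrable_of_bounded_of_eq_zero (C := L * M * M)
      (hDm.aestronglyMeasurable.inner hGm.aestronglyMeasurable)
      (fun x => (norm_inner_le_norm _ _).trans (mul_le_mul (hw.norm_grad_le x) (hv.norm_grad_le x)
        (norm_nonneg _) ((norm_nonneg _).trans (hw.norm_grad_le x)))) hv.isBounded
      fun x hx => by rw [hv.grad_eq_zero x hx, inner_zero_right]
  have i2 : Integrable (fun x => ‖G x‖ ^ 2) volume :=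
    integrable_of_bounded_of_eq_zero (C := M ^ 2) (hGm.norm.pow_const 2).aestronglyMeasurable
      (fun x => by rw [norm_pow, norm_norm]; gcongr; exact hv.norm_grad_le x) hv.isBounded
      fun x hx => by simp [hv.grad_eq_zero x hx]
  have i3 : Integrable (fun x => ‖G (Φ x)‖ ^ 2 * (Φ' x).det) volume :=
    integrable_of_bounded_of_eq_zero (C := M ^ 2 * C)
      (((hGm.comp hΦc.measurable).norm.pow_const 2).mul hJc.measurable).aestronglyMeasurable
      (fun x => by
        rw [norm_mul, norm_pow, norm_norm, Real.norm_eq_abs, abs_of_nonneg (hdet x)]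
        exact mul_le_mul (by gcongr; exact hv.norm_grad_le _) (hC x) (hdet x) (by positivity))
      hv.isBounded fun x hx => by simp [hv.grad_eq_zero _ (hout x hx)]
  have i4 : Integrable (fun x => ‖D x - G x‖ ^ 2) volume :=
    integrable_of_bounded_of_eq_zero (C := (L * M + M) ^ 2)
      ((hDm.sub hGm).norm.pow_const 2).aestronglyMeasurable
      (fun x => by
        rw [norm_pow, norm_norm]; gcongr
        exact (norm_sub_le _ _).trans (add_le_add (hw.norm_grad_le x) (hv.norm_grad_le x)))
      hv.isBounded fun x hx => by simp [hv.grad_eq_zero _ hx, hD0 x hx]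
  have i5 : Integrable (fun x => h x * v (Φ x)) volume :=
    (hh.mul hw.continuous).integrable_of_eq_zero hv.isBounded fun x hx => by simp [hh0 x hx]
  have i6 : Integrable (fun x => h x * v x) volume :=
    (hh.mul hv.continuous).integrable_of_eq_zero hv.isBounded fun x hx => by simp [hh0 x hx]
  have i7 : Integrable (fun x => F (v (Φ x)) * (Φ' x).det) volume :=
    ((hF.comp hw.continuous).mul hJc).integrable_of_eq_zero hv.isBounded fun x hx => by
      simp [hv.eq_zero _ (hout x hx), hF0]
  have i8 : Integrable (fun x => F (v x)) volume :=
    (hF.comp hv.continuous).integrable_of_eq_zero hv.isBounded fun x hx => by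
      simp [hv.eq_zero _ hx, hF0]
  have i9 : Integrable (fun x => inner ℝ (G x) (G x)) volume := by
    simpa only [real_inner_self_eq_norm_sq] using i2
  -- Completing the square: apart from `‖D - G‖²/2`, every bracket integrates to zero, by the weak
  -- equation or by the change of variables.
  have key : ∀ x, (‖D x‖ ^ 2 - ‖G (Φ x)‖ ^ 2 * (Φ' x).det) / 2 - h x * (v (Φ x) - v x)
        + (F (v (Φ x)) * (Φ' x).det - F (v x)) =
      ‖D x - G x‖ ^ 2 / 2 + ((‖G x‖ ^ 2 - ‖G (Φ x)‖ ^ 2 * (Φ' x).det) / 2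
        + ((inner ℝ (D x) (G x) - h x * v (Φ x)) + ((h x * v x - inner ℝ (G x) (G x))
        + (F (v (Φ x)) * (Φ' x).det - F (v x))))) := by
    intro x
    rw [norm_sub_sq_real, real_inner_self_eq_norm_sq]; ring
  refine le_of_le_of_eq ?_ (integral_congr_ae (ae_of_all _ key)).symm
  have j1 : Integrable (fun x => (‖G x‖ ^ 2 - ‖G (Φ x)‖ ^ 2 * (Φ' x).det) / 2) volume :=
    (i2.sub i3).div_const 2
  have j2 : Integrable (fun x => inner ℝ (D x) (G x) - h x * v (Φ x)) volume := i1.sub i5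
  have j3 : Integrable (fun x => h x * v x - inner ℝ (G x) (G x)) volume := i6.sub i9
  have j4 : Integrable (fun x => F (v (Φ x)) * (Φ' x).det - F (v x)) volume := i7.sub i8
  have j34 : Integrable (fun x => (h x * v x - inner ℝ (G x) (G x))
      + (F (v (Φ x)) * (Φ' x).det - F (v x))) volume := j3.add j4
  have j234 : Integrable (fun x => (inner ℝ (D x) (G x) - h x * v (Φ x))
      + ((h x * v x - inner ℝ (G x) (G x)) + (F (v (Φ x)) * (Φ' x).det - F (v x)))) volume :=
    j2.add j34
  have j1234 : Integrable (fun x => (‖G x‖ ^ 2 - ‖G (Φ x)‖ ^ 2 * (Φ' x).det) / 2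
      + ((inner ℝ (D x) (G x) - h x * v (Φ x)) + ((h x * v x - inner ℝ (G x) (G x))
      + (F (v (Φ x)) * (Φ' x).det - F (v x))))) volume := j1.add j234
  rw [integral_add (i4.div_const 2) j1234, integral_add j1 j234, integral_add j2 j34,
    integral_add j3 j4, integral_div, integral_div, integral_sub i2 i3, integral_sub i1 i5,
    integral_sub i6 i9, integral_sub i7 i8,
    e1, e2, e3, e4]
  have : 0 ≤ ∫ x, ‖D x - G x‖ ^ 2 := integral_nonneg fun x => by positivity
  linarith

/-- Pohozaev's inequality for a `C¹` weak solution and a vector field pointing outwards. -/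
theorem pohozaev_inequality {Ω : Set E} {v : E → ℝ} {G : E → E} {M : ℝ}
    (hv : IsZeroExtension Ω v G M) {f : ℝ → ℝ} (hf : Continuous f) (hf0 : f 0 = 0)
    (hweak : ∀ φ : E → ℝ, ContDiff ℝ ∞ φ → HasCompactSupport φ → tsupport φ ⊆ Ω →
      ∫ x, fderiv ℝ φ x (G x) = ∫ x, f (v x) * φ x)
    {W : E → E} (hW : ContDiff ℝ 1 W) (hWc : HasCompactSupport W)
    (hout : ∀ᶠ s : ℝ in 𝓝[>] 0, ∀ x ∉ Ω, x + s • W x ∉ Ω) :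
    0 ≤ ∫ x, (inner ℝ (fderiv ℝ W x (G x)) (G x) + LinearMap.trace ℝ E (fderiv ℝ W x).toLinearMap *
      ((∫ τ in (0 : ℝ)..v x, f τ) - ‖G x‖ ^ 2 / 2)) := by
  set F : ℝ → ℝ := fun t => ∫ τ in (0 : ℝ)..t, f τ with hFdef
  have hFd : ∀ t, HasDerivAt F (f t) t := fun t => (hf.integral_hasStrictDerivAt 0 t).hasDerivAt
  have hFc : Continuous F := continuous_iff_continuousAt.2 fun t => (hFd t).continuousAt
  have hF0 : F 0 = 0 := by simp [hFdef]
  have hM : 0 ≤ M := (norm_nonneg _).trans (hv.norm_grad_le 0)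
  have hWdc : Continuous (fderiv ℝ W) := hW.continuous_fderiv (by simp)
  obtain ⟨K, hK⟩ := (hWc.fderiv ℝ).exists_bound_of_continuous hWdc
  have hK0 : 0 ≤ K := (norm_nonneg _).trans (hK 0)
  obtain ⟨N, hN⟩ := hWc.exists_bound_of_continuous hW.continuous
  have hN0 : 0 ≤ N := (norm_nonneg _).trans (hN 0)
  obtain ⟨KL, hKL⟩ := ContDiff.lipschitzWith_of_hasCompactSupport hWc hW one_ne_zero
  obtain ⟨C, hC0, hC⟩ := exists_abs_det_one_add_smul_sub_one_le (E := E) K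
  obtain ⟨R, hR⟩ := hv.hasCompactSupport.exists_bound_of_continuous hv.continuous
  have hR0 : 0 ≤ R := (norm_nonneg _).trans (hR 0)
  obtain ⟨H, hH⟩ := (isCompact_Icc (a := -R) (b := R)).exists_bound_of_continuousOn hf.continuousOn
  have hvR : ∀ x, v x ∈ Icc (-R) R := fun x => abs_le.1 (hR x)
  have hH0 : 0 ≤ H := (norm_nonneg _).trans (hH _ (hvR 0))
  have hFlip : ∀ t ∈ Icc (-R) R, ∀ t' ∈ Icc (-R) R, |F t - F t'| ≤ H * |t - t'| :=
    fun t ht t' ht' => Convex.norm_image_sub_le_of_norm_hasDerivWithin_le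
      (fun r _ => (hFd r).hasDerivWithinAt) hH (convex_Icc _ _) ht' ht
  have hFb : ∀ x, |F (v x)| ≤ H * R := fun x => by
    have := hFlip (v x) (hvR x) 0 ⟨by linarith, hR0⟩
    rw [hF0, sub_zero, sub_zero] at this
    exact this.trans (by gcongr; exact hR x)
  obtain ⟨Λ, hΛ⟩ := IsZeroExtension.exists_lipschitz_bound (E := E)
  have hΛ := hΛ hv
  set ΛN := |Λ * M| * N with hΛN
  set J : ℝ → E → ℝ := fun s x => (1 + s • fderiv ℝ W x).det with hJ
  set Φ : ℝ → E → E := fun s x => x + s • W x with hΦ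
  set D : ℝ → E → E := fun s x =>
    ContinuousLinearMap.adjoint (1 + s • fderiv ℝ W x) (G (Φ s x)) with hD
  set I : ℝ → E → ℝ := fun s x => (‖D s x‖ ^ 2 - ‖G (Φ s x)‖ ^ 2 * J s x) / 2
    - f (v x) * (v (Φ s x) - v x) + (F (v (Φ s x)) * J s x - F (v x)) with hI
  -- The energy integrand `I` divided by `s`. Both gradient terms are evaluated at `Φ s x`, so the
  -- quotient needs no derivative of `G`. As `s → 0⁺` the two terms `f(v)⟨G, W⟩` cancel.
  set Q : ℝ → E → ℝ := fun s x => inner ℝ (fderiv ℝ W x (G (Φ s x))) (G (Φ s x))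
    + s * ‖ContinuousLinearMap.adjoint (fderiv ℝ W x) (G (Φ s x))‖ ^ 2 / 2
    - ‖G (Φ s x)‖ ^ 2 * (s⁻¹ * (J s x - 1)) / 2 - f (v x) * (s⁻¹ * (v (Φ s x) - v x))
    + F (v (Φ s x)) * (s⁻¹ * (J s x - 1)) + s⁻¹ * (F (v (Φ s x)) - F (v x)) with hQ
  have hIQ : ∀ s : ℝ, s ≠ 0 → ∀ x, s⁻¹ * I s x = Q s x := by
    intro s hs x
    have e : D s x = G (Φ s x) + s • ContinuousLinearMap.adjoint (fderiv ℝ W x) (G (Φ s x)) := by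
      simp only [hD, map_add, map_smulₛₗ]
      have : ContinuousLinearMap.adjoint (1 : E →L[ℝ] E) = 1 :=
        ContinuousLinearMap.adjoint_id
      rw [this]
      simp
    have e2 : ‖D s x‖ ^ 2 = ‖G (Φ s x)‖ ^ 2 + 2 * (s * inner ℝ (fderiv ℝ W x (G (Φ s x))) (G (Φ s x)))
        + s ^ 2 * ‖ContinuousLinearMap.adjoint (fderiv ℝ W x) (G (Φ s x))‖ ^ 2 := by
      rw [e, norm_add_sq_real, real_inner_smul_right, ContinuousLinearMap.adjoint_inner_right,
        norm_smul, mul_pow, Real.norm_eq_abs, sq_abs]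
    simp only [hI, hQ, e2]
    field_simp
    ring
  have hsmall : ∀ᶠ s : ℝ in 𝓝[>] 0, 0 < s ∧ s ≤ 1 ∧ s * KL < 1 ∧ C * s < 1 := by
    have t1 : Tendsto (fun s : ℝ => s) (𝓝[>] 0) (𝓝 0) := nhdsWithin_le_nhds
    have t2 : Tendsto (fun s : ℝ => s * KL) (𝓝[>] 0) (𝓝 0) := by
      simpa using t1.mul_const (KL : ℝ)
    have t3 : Tendsto (fun s : ℝ => C * s) (𝓝[>] 0) (𝓝 0) := by
      simpa using t1.const_mul C
    filter_upwards [self_mem_nhdsWithin, t1.eventually_le_const one_pos,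
      t2.eventually_lt_const one_pos, t3.eventually_lt_const one_pos] with s h1 h2 h3 h4
    exact ⟨h1, h2, h3, h4⟩
  have hΦd : ∀ s x, HasFDerivAt (Φ s) (1 + s • fderiv ℝ W x) x := fun s x =>
    (hasFDerivAt_id x).add ((hW.differentiable (by simp) x).hasFDerivAt.const_smul s)
  have hJ1 : ∀ s : ℝ, 0 < s → s ≤ 1 → ∀ x, |J s x - 1| ≤ C * s := fun s hs hs1 x =>
    hC _ (hK x) s hs.le hs1
  have hnonneg : ∀ᶠ s : ℝ in 𝓝[>] 0, 0 ≤ ∫ x, Q s x := by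
    filter_upwards [hsmall, hout] with s hs hso
    obtain ⟨hs0, hs1, hsK, hsC⟩ := hs
    simp_rw [← hIQ s hs0.ne']
    rw [integral_const_mul]
    refine mul_nonneg (inv_nonneg.2 hs0.le) ?_
    refine integral_energy_comp_nonneg hv (hf.comp hv.continuous)
      (fun x hx => by simp [hv.eq_zero x hx, hf0]) hweak hFc hF0 (L := 1 + K) (C := 1 + C)
      (hΦd s) (continuous_const.add (hWdc.const_smul s)) (fun x => ?_) (fun x => ?_) (fun x => ?_)
      (bijective_add_smul_of_lipschitz hKL hs0.le hsK) hso
    · refine (norm_add_le _ _).trans ?_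
      refine add_le_add ContinuousLinearMap.norm_id_le ?_
      rw [norm_smul, Real.norm_eq_abs, abs_of_pos hs0]
      exact (mul_le_of_le_one_left (norm_nonneg _) hs1).trans (hK x)
    · have := (abs_le.1 (hJ1 s hs0 hs1 x)).2
      simp only [hJ] at this
      nlinarith
    · have := (abs_le.1 (hJ1 s hs0 hs1 x)).1
      simp only [hJ] at this
      linarith
  set Cb := K * M * M + (K * M) ^ 2 / 2 + M ^ 2 * C / 2 + H * ΛN + H * R * C + H * ΛN with hCb
  refine ge_of_tendsto (tendsto_integral_filter_of_dominated_convergence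
    (F := Q) (Ω.indicator fun _ => Cb) ?_ ?_ ?_ (ae_of_all _ fun x => ?_)) hnonneg
  · filter_upwards [hsmall] with s hs
    refine Measurable.aestronglyMeasurable ?_
    have hΦc : Continuous (Φ s) := continuous_id.add (hW.continuous.const_smul s)
    have hGm : Measurable fun x => G (Φ s x) := hv.measurable_grad.comp hΦc.measurable
    have hJm : Measurable (J s) := (ContinuousLinearMap.contDiff_det.continuous.comp
      (continuous_const.add (hWdc.const_smul s))).measurable
    have hD1 : Measurable fun x => fderiv ℝ W x (G (Φ s x)) :=
      (isBoundedBilinearMap_apply.continuous (𝕜 := ℝ)).measurable2 hWdc.measurable hGm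
    have hD2 : Measurable fun x => ContinuousLinearMap.adjoint (fderiv ℝ W x) (G (Φ s x)) :=
      (isBoundedBilinearMap_apply.continuous (𝕜 := ℝ)).measurable2
        (ContinuousLinearMap.adjoint.continuous.comp hWdc).measurable hGm
    have hvm := hv.continuous.measurable
    have hvm2 := (hv.continuous.comp hΦc).measurable
    have hfm := (hf.comp hv.continuous).measurable
    have hFm := (hFc.comp hv.continuous).measurable
    have hFm2 := (hFc.comp (hv.continuous.comp hΦc)).measurable
    simp only [Function.comp_def] at hvm2 hfm hFm hFm2
    exact (((((hD1.inner hGm).add (((hD2.norm.pow_const 2).const_mul s).div_const 2)).sub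
      (((hGm.norm.pow_const 2).mul ((hJm.sub_const 1).const_mul s⁻¹)).div_const 2)).sub
      (hfm.mul ((hvm2.sub hvm).const_mul s⁻¹))).add
      (hFm2.mul ((hJm.sub_const 1).const_mul s⁻¹))).add ((hFm2.sub hFm).const_mul s⁻¹)
  · filter_upwards [hsmall, hout] with s hs hso
    obtain ⟨hs0, hs1, hsK, hsC⟩ := hs
    refine ae_of_all _ fun x => ?_
    by_cases hx : x ∈ Ω
    · rw [indicator_of_mem hx]
      set g := G (Φ s x) with hg
      have hgM : ‖g‖ ≤ M := hv.norm_grad_le _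
      have b1 : |inner ℝ (fderiv ℝ W x g) g| ≤ K * M * M :=
        (abs_real_inner_le_norm _ _).trans (by
          gcongr
          exact (ContinuousLinearMap.le_opNorm _ _).trans (by gcongr; exact hK x))
      have b2 : |s * ‖ContinuousLinearMap.adjoint (fderiv ℝ W x) g‖ ^ 2 / 2| ≤ (K * M) ^ 2 / 2 := by
        rw [abs_of_nonneg (by positivity)]
        have : ‖ContinuousLinearMap.adjoint (fderiv ℝ W x) g‖ ≤ K * M := by
          refine (ContinuousLinearMap.le_opNorm _ _).trans ?_
          rw [LinearIsometryEquiv.norm_map]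
          gcongr
          exact hK x
        have h2 : ‖ContinuousLinearMap.adjoint (fderiv ℝ W x) g‖ ^ 2 ≤ (K * M) ^ 2 := by gcongr
        nlinarith [sq_nonneg ‖ContinuousLinearMap.adjoint (fderiv ℝ W x) g‖]
      have bJ : |s⁻¹ * (J s x - 1)| ≤ C := by
        rw [abs_mul, abs_of_pos (inv_pos.2 hs0), inv_mul_le_iff₀ hs0, mul_comm s C]
        exact hJ1 s hs0 hs1 x
      have b3 : |‖g‖ ^ 2 * (s⁻¹ * (J s x - 1)) / 2| ≤ M ^ 2 * C / 2 := by
        rw [abs_div, abs_mul, abs_two, abs_of_nonneg (sq_nonneg ‖g‖)]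
        gcongr
      -- The global Lipschitz bound is needed here, since `Φ s x` may lie outside `Ω`.
      have bv : |v (Φ s x) - v x| ≤ s * ΛN := by
        refine (hΛ _ _).trans ?_
        have : ‖Φ s x - x‖ ≤ s * N := by
          simp only [hΦ, add_sub_cancel_left]
          rw [norm_smul, Real.norm_eq_abs, abs_of_pos hs0]; gcongr; exact hN x
        calc _ ≤ |Λ * M| * (s * N) := by gcongr; exact le_abs_self _
          _ = _ := by ring
      have b4 : |f (v x) * (s⁻¹ * (v (Φ s x) - v x))| ≤ H * ΛN := by
        rw [abs_mul]
        gcongr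
        · exact hH _ (hvR x)
        · rwa [abs_mul, abs_of_pos (inv_pos.2 hs0), inv_mul_le_iff₀ hs0]
      have b5 : |F (v (Φ s x)) * (s⁻¹ * (J s x - 1))| ≤ H * R * C := by
        rw [abs_mul]
        gcongr
        exact hFb _
      have b6 : |s⁻¹ * (F (v (Φ s x)) - F (v x))| ≤ H * ΛN := by
        rw [abs_mul, abs_of_pos (inv_pos.2 hs0), inv_mul_le_iff₀ hs0]
        refine (hFlip _ (hvR _) _ (hvR _)).trans ?_
        calc _ ≤ H * (s * ΛN) := by gcongr
          _ = _ := by ring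
      simp only [hQ, ← hg]
      rw [Real.norm_eq_abs, abs_le]
      rw [abs_le] at b1 b2 b3 b4 b5 b6
      constructor <;> linarith [b1.1, b1.2, b2.1, b2.2, b3.1, b3.2, b4.1, b4.2, b5.1, b5.2, b6.1,
        b6.2]
    · rw [indicator_of_notMem hx]
      have h1 : G (Φ s x) = 0 := hv.grad_eq_zero _ (hso x hx)
      have h2 : v (Φ s x) = 0 := hv.eq_zero _ (hso x hx)
      simp [hQ, h1, h2, hv.eq_zero x hx, hF0]
  · rw [integrable_indicator_iff hv.isOpen.measurableSet]
    exact integrableOn_const hv.isBounded.measure_lt_top.ne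
  · by_cases hx : x ∈ Ω
    · have t0 : Tendsto (fun s : ℝ => s) (𝓝[>] 0) (𝓝 0) := nhdsWithin_le_nhds
      have tΦ : Tendsto (fun s : ℝ => Φ s x) (𝓝[>] 0) (𝓝 x) := by
        simpa using (t0.smul_const (W x)).const_add x
      have tG : Tendsto (fun s : ℝ => G (Φ s x)) (𝓝[>] 0) (𝓝 (G x)) :=
        (hv.continuousOn_grad.continuousAt (hv.isOpen.mem_nhds hx)).tendsto.comp tΦ
      have tv : Tendsto (fun s : ℝ => v (Φ s x)) (𝓝[>] 0) (𝓝 (v x)) :=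
        (hv.continuous.tendsto x).comp tΦ
      have tF : Tendsto (fun s : ℝ => F (v (Φ s x))) (𝓝[>] 0) (𝓝 (F (v x))) :=
        (hFc.tendsto _).comp tv
      have tJ := tendsto_det_one_add_smul_slope (fderiv ℝ W x)
      have hvd := (hv.hasGradientAt x hx).hasFDerivAt
      have tv' : Tendsto (fun s : ℝ => s⁻¹ * (v (Φ s x) - v x)) (𝓝[>] 0)
          (𝓝 (inner ℝ (G x) (W x))) := by
        have := (hvd.hasLineDerivAt (W x)).tendsto_slope_zero_right
        simpa using this
      have tF' : Tendsto (fun s : ℝ => s⁻¹ * (F (v (Φ s x)) - F (v x))) (𝓝[>] 0)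
          (𝓝 (f (v x) * inner ℝ (G x) (W x))) := by
        have := (((hFd (v x)).comp_hasFDerivAt x hvd).hasLineDerivAt (W x)).tendsto_slope_zero_right
        simpa using this
      have tB1 : Tendsto (fun s : ℝ => inner ℝ (fderiv ℝ W x (G (Φ s x))) (G (Φ s x))) (𝓝[>] 0)
          (𝓝 (inner ℝ (fderiv ℝ W x (G x)) (G x))) :=
        (((fderiv ℝ W x).continuous.tendsto _).comp tG).inner tG
      have tB2 : Tendsto (fun s : ℝ => s * ‖ContinuousLinearMap.adjoint (fderiv ℝ W x)
          (G (Φ s x))‖ ^ 2 / 2) (𝓝[>] 0)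
          (𝓝 (0 * ‖ContinuousLinearMap.adjoint (fderiv ℝ W x) (G x)‖ ^ 2 / 2)) :=
        (t0.mul ((((ContinuousLinearMap.adjoint (fderiv ℝ W x)).continuous.tendsto _).comp
          tG).norm.pow 2)).div_const 2
      have := ((((tB1.add tB2).sub (((tG.norm.pow 2).mul tJ).div_const 2)).sub
        (tv'.const_mul (f (v x)))).add (tF.mul tJ)).add tF'
      convert this using 2
      ring
    · refine tendsto_const_nhds.congr' ?_
      filter_upwards [hout] with s hso
      have h1 : G (Φ s x) = 0 := hv.grad_eq_zero _ (hso x hx)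
      have h2 : v (Φ s x) = 0 := hv.eq_zero _ (hso x hx)
      simp [hQ, h1, h2, hv.eq_zero x hx, hv.grad_eq_zero x hx, hF0]

end

/-! ### From the inequality to the Dirichlet problem. -/

theorem apply_zero_eq_zero_of_mul_nonneg {f : ℝ → ℝ} (hf : Continuous f)
    (h : ∀ t, 0 ≤ t * f t) : f 0 = 0 := by
  refine le_antisymm ?_ ?_
  · refine le_of_tendsto ((hf.tendsto 0).mono_left (nhdsWithin_le_nhds (s := Iio 0))) ?_
    filter_upwards [self_mem_nhdsWithin] with t ht
    exact nonpos_of_mul_nonneg_right (h t) ht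
  · refine ge_of_tendsto ((hf.tendsto 0).mono_left (nhdsWithin_le_nhds (s := Ioi 0))) ?_
    filter_upwards [self_mem_nhdsWithin] with t ht
    exact nonneg_of_mul_nonneg_right (h t) ht

section
variable {n : ℕ} {f : ℝ → ℝ} {Ω : Set (EuclideanSpace ℝ (Fin n))}
  {u : EuclideanSpace ℝ (Fin n) → ℝ}

theorem isDirichletSolution_of_eq_zero (hΩ : IsOpen Ω) (hf0 : f 0 = 0)
    (hu : ∀ x ∈ closure Ω, u x = 0) : IsDirichletSolution f Ω u := by
  have hgrad : ∀ x ∈ Ω, HasGradientAt u 0 x := fun x hx => by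
    refine (hasGradientAt_const x (0 : ℝ)).congr_of_eventuallyEq ?_
    filter_upwards [hΩ.mem_nhds hx] with y hy using hu y (subset_closure hy)
  refine ⟨⟨continuousOn_const.congr hu, fun _ => 0, continuousOn_const, hgrad⟩, ?_,
    fun x hx => hu x (frontier_subset_closure hx)⟩
  intro φ _ _ _
  rw [setIntegral_eq_zero_of_forall_eq_zero fun x hx => by
      rw [(hgrad x hx).gradient, inner_zero_left],
    setIntegral_eq_zero_of_forall_eq_zero fun x hx => by
      rw [hu x (subset_closure hx), hf0, zero_mul]]

/-- A Dirichlet solution, extended by zero, in terms of the weak equation on the whole space. -/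
theorem IsDirichletSolution.exists_isZeroExtension (hΩ : IsOpen Ω) (hΩb : Bornology.IsBounded Ω)
    (hu : IsDirichletSolution f Ω u) :
    ∃ G M, IsZeroExtension Ω (Ω.indicator u) G M ∧
      ∀ φ : EuclideanSpace ℝ (Fin n) → ℝ, ContDiff ℝ ∞ φ → HasCompactSupport φ → tsupport φ ⊆ Ω →
        ∫ x, fderiv ℝ φ x (G x) = ∫ x, f (Ω.indicator u x) * φ x := by
  obtain ⟨hc, G, hGc, hG⟩ := hu.regular
  obtain ⟨M, hM⟩ := hΩb.isCompact_closure.exists_bound_of_continuousOn hGc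
  refine ⟨Ω.indicator G, max M 0, ⟨hΩ, hΩb, continuous_indicator hu.boundary hc,
    fun x hx => indicator_of_notMem hx _, fun x hx => ?_, ?_, fun x hx => indicator_of_notMem hx _,
    fun x => ?_⟩, fun φ hφ hφc hφΩ => ?_⟩
  · rw [indicator_of_mem hx]
    refine (hG x hx).congr_of_eventuallyEq ?_
    filter_upwards [hΩ.mem_nhds hx] with y hy using indicator_of_mem hy _
  · exact (hGc.mono subset_closure).congr fun x hx => indicator_of_mem hx _
  · by_cases hx : x ∈ Ω
    · rw [indicator_of_mem hx]; exact (hM x (subset_closure hx)).trans (le_max_left _ _)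
    · rw [indicator_of_notMem hx, norm_zero]; exact le_max_right _ _
  · have h := hu.equation φ hφ hφc hφΩ
    rw [← integral_indicator hΩ.measurableSet, ← integral_indicator hΩ.measurableSet] at h
    have hφ0 : ∀ x ∉ Ω, φ x = 0 := fun x hx =>
      image_eq_zero_of_notMem_tsupport fun hx' => hx (hφΩ hx')
    convert h using 1
    · congr 1; ext x
      by_cases hx : x ∈ Ω
      · rw [indicator_of_mem hx, indicator_of_mem hx, (hG x hx).gradient, real_inner_comm]
        simp [gradient]
      · rw [indicator_of_notMem hx, indicator_of_notMem hx, map_zero]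
    · congr 1; ext x
      by_cases hx : x ∈ Ω
      · rw [indicator_of_mem hx, indicator_of_mem hx]
      · rw [indicator_of_notMem hx, indicator_of_notMem hx, hφ0 x hx, mul_zero]

end

section
variable {E : Type*} [NormedAddCommGroup E] [InnerProductSpace ℝ E] [FiniteDimensional ℝ E]
  [MeasurableSpace E] [BorelSpace E]

/-- A weak solution vanishes when an outward field satisfies a strict Pohozaev-type bound. -/
theorem IsZeroExtension.eq_zero_of_outward_field [Nontrivial E] {Ω : Set E} {v : E → ℝ} {G : E → E}
    {M : ℝ} (hv : IsZeroExtension Ω v G M) {f : ℝ → ℝ} (hf : Continuous f) {p : ℝ} (hp : 0 < p)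
    (hfp : ∀ t : ℝ, p * (∫ τ in (0 : ℝ)..t, f τ) ≤ t * f t ∧ 0 ≤ p * ∫ τ in (0 : ℝ)..t, f τ)
    (hweak : ∀ φ : E → ℝ, ContDiff ℝ ∞ φ → HasCompactSupport φ → tsupport φ ⊆ Ω →
      ∫ x, fderiv ℝ φ x (G x) = ∫ x, f (v x) * φ x)
    {W : E → E} (hW : ContDiff ℝ 1 W) (hWc : HasCompactSupport W)
    (hout : ∀ᶠ s : ℝ in nhdsWithin 0 (Ioi 0), ∀ x ∉ Ω, x + s • W x ∉ Ω)
    {α β₁ β₂ : ℝ} (hα : ∀ x ∈ Ω, ∀ ξ, inner ℝ (fderiv ℝ W x ξ) ξ ≤ α * ‖ξ‖ ^ 2)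
    (hβ₁ : ∀ x ∈ Ω, β₁ ≤ LinearMap.trace ℝ E (fderiv ℝ W x).toLinearMap)
    (hβ₂ : ∀ x ∈ Ω, LinearMap.trace ℝ E (fderiv ℝ W x).toLinearMap ≤ β₂) (hβ₂0 : 0 ≤ β₂)
    (hneg : α - β₁ / 2 + β₂ / p < 0) (x : E) : v x = 0 := by
  have hf0 : f 0 = 0 := apply_zero_eq_zero_of_mul_nonneg hf fun t => (hfp t).2.trans (hfp t).1
  have hpoh := pohozaev_inequality hv hf hf0 hweak hW hWc hout
  have hfv : Continuous fun x => f (v x) := hf.comp hv.continuous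
  have hfv0 : ∀ x ∉ Ω, f (v x) = 0 := fun x hx => by rw [hv.eq_zero x hx, hf0]
  have henergy : ∫ x, ‖G x‖ ^ 2 = ∫ x, f (v x) * v x := by
    have := hv.weak_equation hv.isOpen hv.integrable_grad hfv
      (HasCompactSupport.of_support_subset_isCompact hv.isBounded.isCompact_closure fun x hx =>
        subset_closure (by_contra fun hxS => hx (hfv0 x hxS))) hweak Subset.rfl
    simpa only [real_inner_self_eq_norm_sq] using this
  have hGm := hv.measurable_grad
  have hM : 0 ≤ M := (norm_nonneg _).trans (hv.norm_grad_le 0)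
  have hWdc : Continuous (fderiv ℝ W) := hW.continuous_fderiv (by simp)
  obtain ⟨K, hK⟩ := (hWc.fderiv ℝ).exists_bound_of_continuous hWdc
  have i1 : Integrable (fun x => ‖G x‖ ^ 2) volume :=
    integrable_of_bounded_of_eq_zero (C := M ^ 2) (hGm.norm.pow_const 2).aestronglyMeasurable
      (fun x => by rw [norm_pow, norm_norm]; gcongr; exact hv.norm_grad_le x) hv.isBounded
      fun x hx => by simp [hv.grad_eq_zero x hx]
  have i2 : Integrable (fun x => f (v x) * v x) volume :=
    (hfv.mul hv.continuous).integrable_of_eq_zero hv.isBounded fun x hx => by simp [hfv0 x hx]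
  have i3 : Integrable (fun x => inner ℝ (fderiv ℝ W x (G x)) (G x)) volume := by
    refine (i1.const_mul K).mono' (Measurable.aestronglyMeasurable ?_) (ae_of_all _ fun x => ?_)
    · exact ((isBoundedBilinearMap_apply.continuous (𝕜 := ℝ)).measurable2 hWdc.measurable
        hGm).inner hGm
    · refine (norm_inner_le_norm _ _).trans ?_
      rw [sq, ← mul_assoc]
      gcongr
      exact (ContinuousLinearMap.le_opNorm _ _).trans (by gcongr; exact hK x)
  set t : E → ℝ := fun x => LinearMap.trace ℝ E (fderiv ℝ W x).toLinearMap with ht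
  have htc : Continuous t :=
    ((LinearMap.trace ℝ E).comp
      (ContinuousLinearMap.coeLM ℝ : (E →L[ℝ] E) →ₗ[ℝ] E →ₗ[ℝ] E)).continuous_of_finiteDimensional.comp
        hWdc
  obtain ⟨B, hB⟩ := HasCompactSupport.exists_bound_of_continuous (f := t)
    ((hWc.fderiv ℝ).comp_left (g := fun A : E →L[ℝ] E => LinearMap.trace ℝ E A.toLinearMap)
      (by simp)) htc
  have hFc : Continuous fun r : ℝ => ∫ τ in (0 : ℝ)..r, f τ :=
    intervalIntegral.continuous_primitive (fun a b => hf.intervalIntegrable a b) 0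
  have i4 : Integrable (fun x => ∫ τ in (0 : ℝ)..v x, f τ) volume :=
    (hFc.comp hv.continuous).integrable_of_eq_zero hv.isBounded fun x hx => by
      simp [hv.eq_zero x hx]
  have i5 : Integrable (fun x => t x * ((∫ τ in (0 : ℝ)..v x, f τ) - ‖G x‖ ^ 2 / 2)) volume :=
    (i4.sub (i1.div_const 2)).bdd_mul htc.aestronglyMeasurable (ae_of_all _ hB)
  have hle : ∀ x, inner ℝ (fderiv ℝ W x (G x)) (G x)
      + t x * ((∫ τ in (0 : ℝ)..v x, f τ) - ‖G x‖ ^ 2 / 2)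
      ≤ (α - β₁ / 2) * ‖G x‖ ^ 2 + β₂ / p * (f (v x) * v x) := by
    intro x
    by_cases hx : x ∈ Ω
    · have h1 := hα x hx (G x)
      have h2 : β₁ ≤ t x := hβ₁ x hx
      have h3 : t x ≤ β₂ := hβ₂ x hx
      obtain ⟨h4, h5⟩ := hfp (v x)
      set Fx := ∫ τ in (0 : ℝ)..v x, f τ
      have h6 : 0 ≤ Fx := nonneg_of_mul_nonneg_right h5 hp
      -- Since the primitive is nonnegative, the upper bound on the trace applies to it, whereas the
      -- gradient term uses the lower bound.
      have h7 : t x * Fx ≤ β₂ / p * (f (v x) * v x) := by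
        rw [div_mul_eq_mul_div, le_div_iff₀ hp]
        have h8 : t x * Fx ≤ β₂ * Fx := by gcongr
        have h9 : β₂ * (p * Fx) ≤ β₂ * (v x * f (v x)) := by gcongr
        nlinarith
      nlinarith [sq_nonneg ‖G x‖]
    · simp [hv.grad_eq_zero x hx, hv.eq_zero x hx]
  have hint := integral_mono (i3.add i5) ((i1.const_mul (α - β₁ / 2)).add (i2.const_mul (β₂ / p))) hle
  have hrhs : ∫ x, ((α - β₁ / 2) * ‖G x‖ ^ 2 + β₂ / p * (f (v x) * v x))
      = (α - β₁ / 2 + β₂ / p) * ∫ x, ‖G x‖ ^ 2 := by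
    rw [integral_add (i1.const_mul _) (i2.const_mul _), integral_const_mul, integral_const_mul,
      ← henergy]
    ring
  have hzero : ∫ x, ‖G x‖ ^ 2 = 0 := by
    have h1 : 0 ≤ ∫ x, ‖G x‖ ^ 2 := integral_nonneg fun x => by positivity
    have h2 : 0 ≤ (α - β₁ / 2 + β₂ / p) * ∫ x, ‖G x‖ ^ 2 := hrhs ▸ hpoh.trans hint
    nlinarith
  rw [integral_eq_zero_iff_of_nonneg (fun x => by positivity) i1] at hzero
  have hG0 : EqOn (fun x => ‖G x‖ ^ 2) 0 Ω :=
    Measure.eqOn_open_of_ae_eq (ae_restrict_of_ae hzero) hv.isOpen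
      (hv.continuousOn_grad.norm.pow 2) continuousOn_const
  -- With gradient bound `0` the global Lipschitz estimate makes `v` constant, and it is zero at
  -- some point outside `Ω`; connectedness of `Ω` plays no role.
  have hv0 : IsZeroExtension Ω v G 0 := { hv with
    norm_grad_le := fun x => by
      by_cases hx : x ∈ Ω
      · have : ‖G x‖ ^ 2 = 0 := hG0 hx
        exact (pow_eq_zero_iff two_ne_zero).1 this |>.le
      · rw [hv.grad_eq_zero x hx, norm_zero] }
  obtain ⟨Λ, hΛ⟩ := IsZeroExtension.exists_lipschitz_bound (E := E)
  obtain ⟨y, hy⟩ : ∃ y, y ∉ Ω := by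
    by_contra! h
    exact NormedSpace.unbounded_univ ℝ E (hv.isBounded.subset fun y _ => h y)
  have := hΛ hv0 x y
  rw [hv.eq_zero y hy, sub_zero, mul_zero, zero_mul] at this
  exact abs_nonpos_iff.1 this

end

theorem theorem2p4 (n : ℕ) (hn : 4 ≤ n)
    (γ : ℝ → EuclideanSpace ℝ (Fin n)) (a b : ℝ) (hγ : IsSmoothSimpleClosedCurve γ a b)
    (f : ℝ → ℝ) (hf : Continuous f)
    (p : ℝ) (hp : 2 * ((n : ℝ) - 1) / ((n : ℝ) - 3) < p)
    (hfp : ∀ t : ℝ, p * (∫ τ in (0 : ℝ)..t, f τ) ≤ t * f t ∧ 0 ≤ p * ∫ τ in (0 : ℝ)..t, f τ) :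
    ∃ ε₀ : ℝ, 0 < ε₀ ∧ ∀ ε : ℝ, 0 < ε → ε < ε₀ →
      ∀ u : EuclideanSpace ℝ (Fin n) → ℝ,
        IsDirichletSolution f (Metric.thickening ε (γ '' Icc a b)) u ↔
          ∀ x ∈ closure (Metric.thickening ε (γ '' Icc a b)), u x = 0 := by
  have hn' : (4 : ℝ) ≤ n := by exact_mod_cast hn
  have hp0 : 0 < p := lt_trans (div_pos (by linarith) (by linarith)) hp
  have hf0 : f 0 = 0 := apply_zero_eq_zero_of_mul_nonneg hf fun t => (hfp t).2.trans (hfp t).1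
  have : Nonempty (Fin n) := ⟨⟨0, by omega⟩⟩
  -- `-c` is the Pohozaev coefficient for the exact projection, and `κ * S` (with `S` below) is the
  -- error caused by `κ`; `κ` is chosen so that the error is at most `c / 2`.
  set c := ((n : ℝ) - 3) / 2 - (n - 1) / p with hc
  have hc0 : 0 < c := by
    rw [hc, sub_pos, div_lt_div_iff₀ hp0 two_pos]
    rw [div_lt_iff₀ (by linarith)] at hp
    linarith
  set S := 1 + (n : ℝ) / 2 + n / p with hS
  have hS0 : 0 < S := by positivity
  set κ := min 1 (c / (2 * S)) with hκ
  have hκ0 : 0 < κ := by positivity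
  have hκS : κ * S ≤ c / 2 := by
    calc κ * S ≤ c / (2 * S) * S := by gcongr; exact min_le_right _ _
      _ = c / 2 := by field_simp
  obtain ⟨ε₀, hε₀, P, T, hP, hT, hPT⟩ := hγ.exists_nearest_point_map hκ0
  have hΓ : IsCompact (γ '' Icc a b) :=
    isCompact_Icc.image_of_continuousOn hγ.contDiffOn.continuousOn
  refine ⟨ε₀, hε₀, fun ε hε hεε₀ u => ⟨fun hu => ?_, fun hu =>
    isDirichletSolution_of_eq_zero Metric.isOpen_thickening hf0 hu⟩⟩
  obtain ⟨W, hW, hWc, hWΩ, hout⟩ := exists_outward_field hΓ (min_le_left _ _) hP hT hPT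
    hε hεε₀
  rw [finrank_euclideanSpace_fin] at hWΩ
  obtain ⟨G, M, hv, hweak⟩ := hu.exists_isZeroExtension Metric.isOpen_thickening
    hΓ.isBounded.thickening
  have hzero := hv.eq_zero_of_outward_field hf hp0 hfp hweak hW hWc hout (α := 1 + κ)
    (β₁ := n - 1 - n * κ) (β₂ := n - 1 + n * κ) (fun x hx => (hWΩ x hx).1)
    (fun x hx => by linarith [(abs_le.1 (hWΩ x hx).2).1])
    (fun x hx => by linarith [(abs_le.1 (hWΩ x hx).2).2]) (by nlinarith) (by
      have e : 1 + κ - ((n : ℝ) - 1 - n * κ) / 2 + (n - 1 + n * κ) / p = κ * S - c := by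
        rw [hS, hc]; ring
      rw [e]; linarith)
  intro x hx
  by_cases hxΩ : x ∈ Metric.thickening ε (γ '' Icc a b)
  · simpa [indicator_of_mem hxΩ] using hzero x
  · exact hu.boundary x ⟨hx, fun h => hxΩ (interior_subset h)⟩
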